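/- Let $\Bbbk$ be an algebraically closed field, $n\ge 0$, and let $Q$ be a quiver whose underlying graph is the Dynkin diagram $1 - 2 - \cdots - (n+2)$ of type $\mathbb{A}_{n+2}$. Let $\operatorname{rep} Q$ be the category of finite dimensional representations of $Q$ over $\Bbbk$, and for $1\le i\le j\le n+2$ let $M(i,j)$ be the representation with space $\Bbbk$ at each vertex $\ell$ with $i\le \ell\le j$ and $0$ at the others, with the identity map on each arrow between two vertices of $\{i,\dots,j\}$ and $0$ on the other arrows. Let $P(Q)$ be a convex $(n+3)$-gon in the plane (no vertex lies in the convex hull of the others) with vertices $0,1,\dots,n+2$ ordered strictly from left to right, such that $0$ and $n+2$ lie on a horizontal line $L$ and, for $1\le i\le n+1$, the vertex $i$ lies strictly above $L$ if $Q$ has the arrow $i\to i+1$ and strictly below $L$ if $Q$ has the arrow $i\leftarrow i+1$. For $0\le i<j\le n+2$ let $\gamma(i,j)$ be the line segment between the vertices $i$ and $j$ (a diagonal or a boundary edge), and put $F(\gamma(i,j))=M(i+1,j)$. Two distinct line segments cross if their relative interiors intersect. A triangulation of $P(Q)$ (boundary edges included) is a maximal set of pairwise noncrossing line segments $\gamma(i,j)$.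 A representation $T\in\operatorname{rep}Q$ is almost rigid if it is basic (no indecomposable representation occurs twice as a direct summand) and, for all indecomposable summands $A,B$ of $T$ (including $A\cong B$), either $\operatorname{Ext}^1(A,B)=0$, or $\operatorname{Ext}^1(A,B)$ is one-dimensional and generated by the class of a short exact sequence $0\to B\to E\to A\to 0$ with $E$ indecomposable. It is maximal almost rigid if it is almost rigid and $T\oplus M$ is not almost rigid for every nonzero $M\in\operatorname{rep} Q$. Let $\operatorname{mar}(Q)$ be the set of isomorphism classes of maximal almost rigid representations of $Q$. **Theorem.** The map sending a triangulation $\mathcal{T}$ to the isomorphism class of $\bigoplus_{\gamma\in\mathcal{T}}F(\gamma)$ is a bijection $$F\colon\{\text{triangulations of } P(Q)\}\longrightarrow \operatorname{mar}(Q).$$ Moreover, for any two distinct line segments $\gamma,\delta$, the representation $F(\gamma)\oplus F(\delta)$ is almost rigid if and only if $\gamma$ and $\delta$ do not cross. -/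

import Mathlib

open CategoryTheory CategoryTheory.Limits

universe u

noncomputable section

namespace AlmostRigid

/-! ### The quiver and its representations

An orientation of the Dynkin diagram `1 — 2 — ⋯ — n+2` is a map `ε : Fin (n + 1) → Bool`.
The quiver vertex labelled `ℓ` is the element `ℓ - 1` of `Fin (n + 2)`, and `i : Fin (n + 1)` stands
for the edge between the vertices labelled `i + 1` and `i + 2`. -/

/-- The vertices of the quiver of type `𝔸_{n+2}` with orientation `ε`. -/
def Vertex {n : ℕ} (_ε : Fin (n + 1) → Bool) : Type := Fin (n + 2)

/-- The arrows: the edge `i` is oriented to the right if `ε i = true`, to the left otherwise. -/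
inductive Arrow {n : ℕ} (ε : Fin (n + 1) → Bool) : Fin (n + 2) → Fin (n + 2) → Type
  | right (i : Fin (n + 1)) (h : ε i = true) : Arrow ε i.castSucc i.succ
  | left (i : Fin (n + 1)) (h : ε i = false) : Arrow ε i.succ i.castSucc

instance {n : ℕ} (ε : Fin (n + 1) → Bool) : Quiver.{0} (Vertex ε) where
  Hom a b := Arrow ε a b

/-- The category `rep Q` of finite dimensional representations over `k`. -/
abbrev RepQ (k : Type u) [Field k] {n : ℕ} (ε : Fin (n + 1) → Bool) : Type (u + 1) :=
  Paths (Vertex ε) ⥤ FGModuleCat.{u} k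

instance (k : Type u) [Field k] {n : ℕ} (ε : Fin (n + 1) → Bool) :
    HasExt.{u + 1} (RepQ k ε) :=
  HasExt.standard _

instance (k : Type u) [Field k] {n : ℕ} (ε : Fin (n + 1) → Bool) :
    HasFiniteBiproducts (RepQ k ε) :=
  Abelian.hasFiniteBiproducts

/-! ### Almost rigid representations -/

section

variable {k : Type u} [Field k] {n : ℕ} {ε : Fin (n + 1) → Bool}

/-- `A` is an indecomposable direct summand of `T`. -/
def IsIndecSummand (A T : RepQ k ε) : Prop :=
  Indecomposable A ∧ ∃ Z : RepQ k ε, Nonempty (T ≅ A ⊞ Z)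

/-- `T` is basic: it has no repeated (indecomposable) direct summand. -/
def IsBasic (T : RepQ k ε) : Prop :=
  ∀ A : RepQ k ε, Indecomposable A → ¬ ∃ Z : RepQ k ε, Nonempty (T ≅ (A ⊞ A) ⊞ Z)

/-- `Ext¹(A, B)` is one-dimensional, generated by the class of a short exact sequence
`0 ⟶ B ⟶ E ⟶ A ⟶ 0` with indecomposable middle term. -/
def ExtGeneratedByIndec (A B : RepQ k ε) : Prop :=
  Module.finrank k (Abelian.Ext A B 1) = 1 ∧
    ∃ (E : RepQ k ε) (f : B ⟶ E) (g : E ⟶ A) (w : f ≫ g = 0)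
      (hS : (ShortComplex.mk f g w).ShortExact),
      Submodule.span k {(hS.extClass : Abelian.Ext A B 1)} = ⊤ ∧ Indecomposable E

/-- Almost rigid representations. -/
def IsAlmostRigid (T : RepQ k ε) : Prop :=
  IsBasic T ∧ ∀ A B : RepQ k ε, IsIndecSummand A T → IsIndecSummand B T →
    Subsingleton (Abelian.Ext A B 1) ∨ ExtGeneratedByIndec A B

/-- Maximal almost rigid representations: no nonzero summand can be added. -/
def IsMaximalAlmostRigid (T : RepQ k ε) : Prop :=
  IsAlmostRigid T ∧ ∀ M : RepQ k ε, ¬ IsZero M → ¬ IsAlmostRigid (T ⊞ M)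

end

/-- The set `mar(Q)` of isomorphism classes of maximal almost rigid representations. -/
def mar (k : Type u) [Field k] {n : ℕ} (ε : Fin (n + 1) → Bool) :
    Set (Quotient (isIsomorphicSetoid (RepQ k ε))) :=
  {x | ∃ T : RepQ k ε, IsMaximalAlmostRigid T ∧ Quotient.mk _ T = x}

/-! ### The polygon, its line segments and its triangulations -/

/-- `p` draws the polygon `P(Q)` as a convex polygon in the plane: the vertices `0, …, n+2` appear
in order from left to right, `0` and `n+2` lie on a horizontal line, and the vertex `i + 1`
(with `i : Fin (n + 1)`) lies above that line if the edge `i` points to the right, and below it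
otherwise. -/
structure IsPolygon {n : ℕ} (ε : Fin (n + 1) → Bool) (p : Fin (n + 3) → ℝ × ℝ) : Prop where
  left_to_right : StrictMono fun i => (p i).1
  horizontal : (p 0).2 = (p (Fin.last (n + 2))).2
  upper : ∀ i : Fin (n + 1), ε i = true → (p 0).2 < (p i.succ.castSucc).2
  lower : ∀ i : Fin (n + 1), ε i = false → (p i.succ.castSucc).2 < (p 0).2
  convex : ConvexIndependent ℝ p

/-- The line segments `γ(i, j)`, `0 ≤ i < j ≤ n+2`: all diagonals and boundary edges. -/
@[ext]
structure LineSegment (n : ℕ) where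
  i : Fin (n + 3)
  j : Fin (n + 3)
  lt : i < j

/-- The endpoints determine a line segment. -/
theorem LineSegment.injective (n : ℕ) :
    Function.Injective fun γ : LineSegment n => (γ.i, γ.j) := by
  intro a b h
  simp only [Prod.mk.injEq] at h
  exact LineSegment.ext h.1 h.2

instance (n : ℕ) : Finite (LineSegment n) := Finite.of_injective _ (LineSegment.injective n)

/-- Two line segments cross: they are distinct and their relative interiors meet. -/
def Cross {n : ℕ} (p : Fin (n + 3) → ℝ × ℝ) (γ δ : LineSegment n) : Prop :=
  γ ≠ δ ∧ (openSegment ℝ (p γ.i) (p γ.j) ∩ openSegment ℝ (p δ.i) (p δ.j)).Nonempty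

/-- A triangulation (boundary edges included): a maximal set of pairwise noncrossing
line segments. -/
def IsTriangulation {n : ℕ} (p : Fin (n + 3) → ℝ × ℝ) (T : Set (LineSegment n)) : Prop :=
  Maximal (fun S : Set (LineSegment n) => ∀ γ ∈ S, ∀ δ ∈ S, ¬ Cross p γ δ) T

/-! ### The map `F` -/

/-- The linear map `k^a → k^b` between spaces of dimension at most one (`a`, `b` propositions):
the identity of `k` if `a` and `b` hold, and zero otherwise. -/
def indicatorMap (k : Type u) [Field k] (a b : Prop) :
    (PLift a → k) →ₗ[k] (PLift b → k) :=
  open scoped Classical in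
  LinearMap.pi fun _ => if h : a then LinearMap.proj ⟨h⟩ else 0

/-- The interval representation with space `k` at the vertices `v : Fin (n + 2)`
with `a ≤ v < b` and zero elsewhere, and identity maps inside the interval. Since `v` carries
the label `v + 1`, this is `M(a + 1, b)`. -/
def interval (k : Type u) [Field k] {n : ℕ} (ε : Fin (n + 1) → Bool) (a b : ℕ) : RepQ k ε :=
  Paths.lift
    { obj := fun v : Vertex ε =>
        FGModuleCat.of k (PLift (a ≤ Fin.val (n := n + 2) v ∧ Fin.val (n := n + 2) v < b) → k)
      map := fun {_ _} _ => FGModuleCat.ofHom (indicatorMap k _ _) }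

/-- `F(γ(i, j)) = M(i + 1, j)`. -/
def F (k : Type u) [Field k] {n : ℕ} (ε : Fin (n + 1) → Bool) (γ : LineSegment n) : RepQ k ε :=
  interval k ε γ.i γ.j

/-- `F` on sets of line segments: the isomorphism class of `⨁ F(γ)`. -/
def FSet (k : Type u) [Field k] {n : ℕ} (ε : Fin (n + 1) → Bool) (T : Set (LineSegment n)) :
    Quotient (isIsomorphicSetoid (RepQ k ε)) :=
  Quotient.mk _ (⨁ fun γ : T => F k ε γ.1)

end AlmostRigid

end

/-!
The group `Ext¹(A, B)` is the cokernel of the map `∏ᵥ Hom(A v, B v) → ∏_{v → w} Hom(A v, B w)`. For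
interval representations this cokernel can be read off the supports: `Ext¹(F γ, F δ)` is nonzero
exactly when `γ` starts below and ends above `δ` and their spans overlap or touch, where "below" and
"above" depend only on the orientation of the quiver. If the spans only touch, the nonsplit
extension has an interval representation as its middle term. If they overlap, the middle term of any
extension has dimension two somewhere, so it is decomposable, every indecomposable representation
being an interval representation; on the side of the polygon, this is the case where `γ` crosses `δ`
upward. Since interval representations are bricks, a basic representation is determined by the set
of line segments whose representations are its summands, and almost rigidity says that this set has
no crossings.
-/

noncomputable section

namespace AlmostRigid

/-! ### Extensions, retracts and bricks -/

section Yoneda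

open DerivedCategory Pretriangulated

universe w v

variable {C : Type u} [Category.{v} C] [Abelian C]

theorem shortExact_of_distinguished_single [HasDerivedCategory.{w} C] (S : ShortComplex C)
    (h : (singleFunctor C 0).obj S.X₃ ⟶ ((singleFunctor C 0).obj S.X₁)⟦(1 : ℤ)⟧)
    (hT : Triangle.mk ((singleFunctor C 0).map S.f) ((singleFunctor C 0).map S.g) h ∈
      distTriang (DerivedCategory C)) : S.ShortExact := by
  have hδ₁ : HomologySequence.δ (Triangle.mk ((singleFunctor C 0).map S.f)
      ((singleFunctor C 0).map S.g) h) (-1) 0 = 0 :=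
    (isZero_of_isGE ((singleFunctor C 0).obj S.X₃) 0 (-1) (by lia)).eq_of_src _ _
  have hδ₂ : HomologySequence.δ (Triangle.mk ((singleFunctor C 0).map S.f)
      ((singleFunctor C 0).map S.g) h) 0 1 = 0 :=
    (isZero_of_isLE ((singleFunctor C 0).obj S.X₁) 0 1 (by lia)).eq_of_tgt _ _
  have homology_shortExact :
      (S.map (singleFunctor C 0 ⋙ homologyFunctor C 0)).ShortExact :=
    { exact := HomologySequence.exact₂ _ hT 0
      mono_f := (HomologySequence.mono_homologyMap_mor₁_iff _ hT (-1) 0).2 hδ₁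
      epi_g := (HomologySequence.epi_homologyMap_mor₂_iff _ hT 0 1).2 hδ₂ }
  exact (ShortComplex.shortExact_iff_of_iso
    (S.mapNatIso (singleFunctorCompHomologyFunctorIso C 0))).1 homology_shortExact

theorem exists_shortExact_distinguished_single [HasDerivedCategory.{w} C] {A B : C}
    (h : (singleFunctor C 0).obj A ⟶ ((singleFunctor C 0).obj B)⟦(1 : ℤ)⟧) :
    ∃ (E : C) (f : B ⟶ E) (g : E ⟶ A) (w : f ≫ g = 0), (ShortComplex.mk f g w).ShortExact ∧
      Triangle.mk ((singleFunctor C 0).map f) ((singleFunctor C 0).map g) h ∈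
        distTriang (DerivedCategory C) := by
  obtain ⟨Y, f, g, hT⟩ := distinguished_cocone_triangle₂ h
  have := TStructure.t.isLE₂ _ hT 0 (inferInstanceAs (IsLE ((singleFunctor C 0).obj B) 0))
    (inferInstanceAs (IsLE ((singleFunctor C 0).obj A) 0))
  have := TStructure.t.isGE₂ _ hT 0 (inferInstanceAs (IsGE ((singleFunctor C 0).obj B) 0))
    (inferInstanceAs (IsGE ((singleFunctor C 0).obj A) 0))
  change IsLE Y 0 at *
  change IsGE Y 0 at *
  obtain ⟨E, ⟨e⟩⟩ := exists_iso_singleFunctor_obj_of_isGE_of_isLE Y 0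
  obtain ⟨f', hf'⟩ := (singleFunctor C 0).map_surjective (f ≫ e.hom)
  obtain ⟨g', hg'⟩ := (singleFunctor C 0).map_surjective (e.inv ≫ g)
  have w₀ : f ≫ g = 0 := comp_distTriang_mor_zero₁₂ _ hT
  have w : f' ≫ g' = 0 := (singleFunctor C 0).map_injective (by
    rw [Functor.map_comp, hf', hg', Functor.map_zero]; simp [w₀])
  have hT' : Triangle.mk ((singleFunctor C 0).map f') ((singleFunctor C 0).map g') h ∈
      distTriang (DerivedCategory C) := by
    refine isomorphic_distinguished _ hT _
      (Triangle.isoMk _ _ (Iso.refl _) e.symm (Iso.refl _) ?_ ?_ ?_)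
    · change (singleFunctor C 0).map f' ≫ e.inv = 𝟙 ((singleFunctor C 0).obj B) ≫ f
      simp [hf']
    · change (singleFunctor C 0).map g' ≫ 𝟙 ((singleFunctor C 0).obj A) = e.inv ≫ g
      simp [hg']
    · change h ≫ (shiftFunctor (DerivedCategory C) (1 : ℤ)).map
        (𝟙 ((singleFunctor C 0).obj B)) = 𝟙 ((singleFunctor C 0).obj A) ≫ h
      rw [Category.id_comp, CategoryTheory.Functor.map_id]
      exact Category.comp_id _
  exact ⟨E, f', g', w, shortExact_of_distinguished_single (ShortComplex.mk f' g' w) h hT', hT'⟩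

theorem exists_section_of_extClass_eq_zero [HasExt.{w} C] {S : ShortComplex C}
    (hS : S.ShortExact) (h : hS.extClass = 0) : ∃ s : S.X₃ ⟶ S.X₂, s ≫ S.g = 𝟙 S.X₃ := by
  obtain ⟨x, hx⟩ := Abelian.Ext.covariant_sequence_exact₃ S.X₃ hS (Abelian.Ext.mk₀ (𝟙 S.X₃))
    (zero_add 1) (by rw [h, Abelian.Ext.comp_zero])
  obtain ⟨s, rfl⟩ := (Abelian.Ext.mk₀_bijective _ _).2 x
  exact ⟨s, (Abelian.Ext.mk₀_bijective _ _).1 (by simpa using hx)⟩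

theorem subsingleton_ext_one_iff_forall_exists_section [HasExt.{w} C] {A B : C} :
    Subsingleton (Abelian.Ext A B 1) ↔ ∀ (E : C) (f : B ⟶ E) (g : E ⟶ A) (w : f ≫ g = 0),
      (ShortComplex.mk f g w).ShortExact → ∃ s : A ⟶ E, s ≫ g = 𝟙 A := by
  refine ⟨fun h E f g w hS => exists_section_of_extClass_eq_zero hS (h.elim _ _),
    fun h => subsingleton_of_forall_eq 0 fun x => ?_⟩
  let := HasDerivedCategory.standard C
  obtain ⟨E, f, g, w, hS, hT⟩ := exists_shortExact_distinguished_single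
    (show (singleFunctor C 0).obj A ⟶ ((singleFunctor C 0).obj B)⟦(1 : ℤ)⟧ from x.hom)
  have hw : (singleFunctor C 0).map g ≫ x.hom = 0 := comp_distTriang_mor_zero₂₃ _ hT
  have hx : (Abelian.Ext.mk₀ g).comp x (zero_add 1) = 0 := by
    ext
    simp [hw, ShiftedHom.mk₀_comp]
  obtain ⟨s, hs⟩ := h E f g w hS
  rw [← Abelian.Ext.mk₀_id_comp x, ← hs, ← Abelian.Ext.mk₀_comp_mk₀,
    Abelian.Ext.comp_assoc_of_second_deg_zero, hx, Abelian.Ext.comp_zero]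

variable [HasExt.{w} C] {k : Type*} [Field k] [Linear k C]

/-- The isomorphism `Ext¹(A, B) ≃ Ext¹(A', B')` induced by isomorphisms `A ≅ A'` and `B ≅ B'`;
it transports extension classes between isomorphic summands. -/
def extCongr {A A' B B' : C} (e : A ≅ A') (e' : B ≅ B') :
    Abelian.Ext A B 1 ≃ₗ[k] Abelian.Ext A' B' 1 where
  toFun x :=
    (Abelian.Ext.mk₀ e.inv).comp (x.comp (Abelian.Ext.mk₀ e'.hom) (add_zero 1)) (zero_add 1)
  invFun x :=
    (Abelian.Ext.mk₀ e.hom).comp (x.comp (Abelian.Ext.mk₀ e'.inv) (add_zero 1)) (zero_add 1)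
  map_add' x y := by simp
  map_smul' c x := by simp
  left_inv x := by simp
  right_inv x := by simp

end Yoneda

section Retracts

theorem nonempty_retract_of_isIso_comp {C : Type*} [Category* C] {A T : C} (f : A ⟶ T)
    (g : T ⟶ A) [IsIso (f ≫ g)] : Nonempty (Retract A T) :=
  ⟨⟨f, g ≫ inv (f ≫ g), by rw [← Category.assoc, IsIso.hom_inv_id]⟩⟩

section Preadditive

variable {C : Type*} [Category* C] [Preadditive C] [HasBinaryBiproducts C]

theorem comp_eq_add_of_biprod {W X Y Z : C} (f : W ⟶ X ⊞ Y) (g : X ⊞ Y ⟶ Z) :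
    f ≫ g = (f ≫ biprod.fst) ≫ biprod.inl ≫ g + (f ≫ biprod.snd) ≫ biprod.inr ≫ g := by
  conv_lhs => rw [← Category.id_comp g, ← biprod.total]
  simp only [Preadditive.add_comp, Preadditive.comp_add, Category.assoc]

/-- The retraction of a direct sum onto its first summand. -/
def retractBiprodLeft (X Y : C) : Retract X (X ⊞ Y) := ⟨biprod.inl, biprod.fst, biprod.inl_fst⟩

/-- The retraction of a direct sum onto its second summand. -/
def retractBiprodRight (X Y : C) : Retract Y (X ⊞ Y) := ⟨biprod.inr, biprod.snd, biprod.inr_snd⟩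

/-- The direct sum of two retractions. -/
def retractBiprodMap {A B X Y : C} (h : Retract A X) (h' : Retract B Y) :
    Retract (A ⊞ B) (X ⊞ Y) :=
  ⟨biprod.map h.i h'.i, biprod.map h.r h'.r, by ext <;> simp⟩

/-- A finite direct sum indexed by a disjoint union splits accordingly. -/
def biproductSumIso [HasFiniteBiproducts C] {ι κ : Type*} [Finite ι] [Finite κ]
    (X : ι ⊕ κ → C) :
    ⨁ X ≅ (⨁ fun a => X (Sum.inl a)) ⊞ ⨁ fun b => X (Sum.inr b) where
  hom := biproduct.desc fun
    | Sum.inl a => biproduct.ι (fun a => X (Sum.inl a)) a ≫ biprod.inl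
    | Sum.inr b => biproduct.ι (fun b => X (Sum.inr b)) b ≫ biprod.inr
  inv := biprod.desc (biproduct.desc fun a => biproduct.ι X (Sum.inl a))
    (biproduct.desc fun b => biproduct.ι X (Sum.inr b))
  hom_inv_id := biproduct.hom_ext' _ _ (by rintro (a | b) <;> simp)
  inv_hom_id := by ext <;> simp

/-- Adding an index to a finite set adds a direct summand. -/
def biproductInsertIso [HasFiniteBiproducts C] {ι : Type*} (X : ι → C) {S : Set ι} [Finite S]
    {a : ι} (ha : a ∉ S) :
    ⨁ (fun b : ↥(insert a S) => X b) ≅ (⨁ fun b : S => X b) ⊞ X a :=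
  letI := Classical.decPred (· ∈ S)
  (biproduct.whiskerEquiv (Equiv.Set.insert ha).symm
    (f := Sum.elim (fun b : S => X b) fun _ : PUnit => X a)
    (g := fun b : ↥(insert a S) => X b)
    (by rintro (b | b) <;> exact Iso.refl _)).symm ≪≫
  biproductSumIso _ ≪≫ biprod.mapIso (Iso.refl _) (biproductUniqueIso _)

end Preadditive

variable {C : Type*} [Category* C] [Abelian C]

theorem nonempty_retract_iff {A T : C} :
    Nonempty (Retract A T) ↔ ∃ Z : C, Nonempty (T ≅ A ⊞ Z) := by
  refine ⟨fun ⟨h⟩ => ?_, fun ⟨Z, ⟨e⟩⟩ => ⟨(retractBiprodLeft A Z).trans (Retract.ofIso e.symm)⟩⟩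
  exact ⟨_, ⟨biprod.uniqueUpToIso _ _
    (isBilimitBinaryBiconeOfIsSplitMonoOfCokernel (cokernelIsCokernel h.i))⟩⟩

theorem isEmpty_retract_biprod_self {A : C} (hA : Indecomposable A) :
    IsEmpty (Retract (A ⊞ A) A) := by
  refine ⟨fun h => hA.1 ?_⟩
  obtain ⟨Z, ⟨e⟩⟩ := nonempty_retract_iff.1 ⟨h⟩
  exact (hA.2 A (A ⊞ Z) (e ≪≫ biprod.associator A A Z)).elim id
    fun h => ((biprod_isZero_iff A Z).1 h).1

end Retracts

section Bricks

/-- A brick over `k`: a nonzero object all of whose endomorphisms are scalars. Over a field which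
is not algebraically closed this is stronger than asking for a division ring of endomorphisms. -/
structure IsBrick (k : Type*) [Field k] {C : Type*} [Category* C] [Preadditive C] [Linear k C]
    (A : C) : Prop where
  not_isZero : ¬ IsZero A
  exists_eq_smul_id : ∀ φ : A ⟶ A, ∃ c : k, φ = c • 𝟙 A

namespace IsBrick

variable {k : Type*} [Field k] {C : Type*} [Category* C] [Preadditive C] [Linear k C] {A : C}

theorem isIso_of_ne_zero (hA : IsBrick k A) {φ : A ⟶ A} (hφ : φ ≠ 0) : IsIso φ := by
  obtain ⟨c, rfl⟩ := hA.exists_eq_smul_id φ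
  have hc : c ≠ 0 := fun hc => hφ (by rw [hc, zero_smul])
  exact ⟨c⁻¹ • 𝟙 A, by simp [smul_smul, hc], by simp [smul_smul, hc]⟩

theorem comp_eq_zero_of_isEmpty_retract (hA : IsBrick k A) {T : C} (hT : IsEmpty (Retract A T))
    (f : A ⟶ T) (g : T ⟶ A) : f ≫ g = 0 := by
  by_contra h
  have := hA.isIso_of_ne_zero h
  exact (not_nonempty_iff.2 hT) (nonempty_retract_of_isIso_comp f g)

variable [HasBinaryBiproducts C]

theorem indecomposable (hA : IsBrick k A) : Indecomposable A := by
  refine ⟨hA.not_isZero, fun Y Z e => ?_⟩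
  obtain ⟨c, hc⟩ := hA.exists_eq_smul_id (e.hom ≫ biprod.fst ≫ biprod.inl ≫ e.inv)
  have hY : 𝟙 Y = c • 𝟙 Y := by
    simpa using (biprod.inl ≫ e.inv) ≫= hc =≫ (e.hom ≫ biprod.fst)
  have hZ : 0 = c • 𝟙 Z := by
    simpa using (biprod.inr ≫ e.inv) ≫= hc =≫ (e.hom ≫ biprod.snd)
  simp only [IsZero.iff_id_eq_zero]
  rcases eq_or_ne c 0 with rfl | hc0
  · exact Or.inl (by rw [hY, zero_smul])
  · exact Or.inr ((smul_eq_zero_iff_right hc0).1 hZ.symm)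

theorem nonempty_retract_biprod_iff (hA : IsBrick k A) {X Y : C} :
    Nonempty (Retract A (X ⊞ Y)) ↔ Nonempty (Retract A X) ∨ Nonempty (Retract A Y) := by
  refine ⟨fun ⟨h⟩ => ?_, ?_⟩
  · by_contra! hXY
    refine hA.not_isZero ((IsZero.iff_id_eq_zero A).2 ?_)
    rw [← h.retract, comp_eq_add_of_biprod, hA.comp_eq_zero_of_isEmpty_retract hXY.1,
      hA.comp_eq_zero_of_isEmpty_retract hXY.2, add_zero]
  · rintro (⟨⟨h⟩⟩ | ⟨⟨h⟩⟩)
    · exact ⟨h.trans (retractBiprodLeft X Y)⟩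
    · exact ⟨h.trans (retractBiprodRight X Y)⟩

theorem nonempty_retract_biprod_self_left (hA : IsBrick k A) {X Y : C}
    (hY : IsEmpty (Retract A Y)) (h : Retract (A ⊞ A) (X ⊞ Y)) :
    Nonempty (Retract (A ⊞ A) X) := by
  have hYzero : (h.i ≫ biprod.snd) ≫ biprod.inr ≫ h.r = 0 := by
    have hentry (u : A ⟶ A ⊞ A) (v : A ⊞ A ⟶ A) :=
      hA.comp_eq_zero_of_isEmpty_retract hY (u ≫ h.i ≫ biprod.snd) (biprod.inr ≫ h.r ≫ v)
    ext <;> simpa using hentry _ _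
  exact ⟨⟨_, _, by rw [← h.retract, comp_eq_add_of_biprod h.i h.r, hYzero, add_zero]⟩⟩

end IsBrick

theorem IsBrick.span_extClass_eq_top {k : Type*} [Field k] {C : Type*} [Category* C] [Abelian C]
    [Linear k C] [HasExt C] {S : ShortComplex C} (hS : S.ShortExact) (hB : IsBrick k S.X₁)
    [Subsingleton (Abelian.Ext S.X₂ S.X₁ 1)] : Submodule.span k {hS.extClass} = ⊤ := by
  refine eq_top_iff.2 fun x _ => Submodule.mem_span_singleton.2 ?_
  obtain ⟨y, rfl⟩ := Abelian.Ext.contravariant_sequence_exact₃ hS S.X₁ x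
    (Subsingleton.elim _ _) (add_zero 1)
  obtain ⟨φ, rfl⟩ := (Abelian.Ext.mk₀_bijective _ _).2 y
  obtain ⟨c, rfl⟩ := hB.exists_eq_smul_id φ
  exact ⟨c, by rw [Abelian.Ext.smul_eq_comp_mk₀]⟩

end Bricks

/-! ### Representations of a quiver -/

section Representations

/-- The category of finite dimensional representations of a quiver `V` over `k`. -/
abbrev QuiverRep (k : Type u) [Field k] (V : Type*) [Quiver V] : Type _ :=
  Paths V ⥤ FGModuleCat.{u} k

variable {k : Type u} [Field k] {V : Type*} [Quiver V]

/-- The vector space of a representation at a vertex. -/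
abbrev space (M : QuiverRep k V) (v : V) : Type u := (M.obj ((Paths.of V).obj v)).carrier

/-- The linear map of a representation along an arrow. -/
def arrowMap (M : QuiverRep k V) {a b : V} (α : a ⟶ b) : space M a →ₗ[k] space M b :=
  (M.map ((Paths.of V).map α)).hom.hom

/-- The component of a morphism of representations at a vertex. -/
def component {M N : QuiverRep k V} (φ : M ⟶ N) (v : V) : space M v →ₗ[k] space N v :=
  (φ.app ((Paths.of V).obj v)).hom.hom

theorem component_arrowMap {M N : QuiverRep k V} (φ : M ⟶ N) {a b : V} (α : a ⟶ b)
    (x : space M a) : component φ b (arrowMap M α x) = arrowMap N α (component φ a x) :=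
  LinearMap.congr_fun (congrArg (fun f => f.hom.hom) (φ.naturality ((Paths.of V).map α))) x

theorem hom_ext_component {M N : QuiverRep k V} {φ ψ : M ⟶ N}
    (h : ∀ v x, component φ v x = component ψ v x) : φ = ψ :=
  NatTrans.ext (funext fun v => FGModuleCat.hom_ext (LinearMap.ext (h v)))

@[simp] theorem component_id (M : QuiverRep k V) (v : V) :
    component (𝟙 M) v = LinearMap.id := rfl

@[simp] theorem component_comp {M N L : QuiverRep k V} (φ : M ⟶ N) (ψ : N ⟶ L) (v : V) :
    component (φ ≫ ψ) v = component ψ v ∘ₗ component φ v := rfl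

@[simp] theorem component_zero (M N : QuiverRep k V) (v : V) :
    component (0 : M ⟶ N) v = 0 := rfl

theorem component_smul {M N : QuiverRep k V} (c : k) (φ : M ⟶ N) (v : V) :
    component (c • φ) v = c • component φ v := rfl

theorem component_component_of_comp_eq {M N L : QuiverRep k V} {f : M ⟶ N} {g : N ⟶ L}
    {φ : M ⟶ L} (w : f ≫ g = φ) (v : V) (x : space M v) :
    component g v (component f v x) = component φ v x := by
  rw [← w, component_comp, LinearMap.comp_apply]

/-- The morphism of representations given by linear maps at the vertices which commute with the
arrows. -/
def homMk {M N : QuiverRep k V} (h : ∀ v, space M v →ₗ[k] space N v)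
    (comm : ∀ {a b : V} (α : a ⟶ b) (x : space M a),
      h b (arrowMap M α x) = arrowMap N α (h a x)) : M ⟶ N where
  app v := ConcreteCategory.ofHom (C := FGModuleCat k) (h v)
  naturality X Y f := by
    induction f using Paths.induction with
    | id => simp
    | comp p q hp =>
      rename_i b c
      have hq : M.map ((Paths.of V).map q) ≫ ConcreteCategory.ofHom (C := FGModuleCat k) (h c) =
          ConcreteCategory.ofHom (C := FGModuleCat k) (h b) ≫ N.map ((Paths.of V).map q) :=
        FGModuleCat.hom_ext (LinearMap.ext (comm q))
      rw [M.map_comp, N.map_comp, Category.assoc]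
      exact (congrArg (M.map p ≫ ·) hq).trans ((Category.assoc _ _ _).symm.trans
        ((congrArg (· ≫ N.map ((Paths.of V).map q)) hp).trans (Category.assoc _ _ _)))

@[simp] theorem component_homMk {M N : QuiverRep k V} (h : ∀ v, space M v →ₗ[k] space N v)
    (comm : ∀ {a b : V} (α : a ⟶ b) (x : space M a),
      h b (arrowMap M α x) = arrowMap N α (h a x)) (v : V) :
    component (homMk h comm) v = h v := rfl

theorem finrank_space_eq_of_iso {M N : QuiverRep k V} (e : M ≅ N) (v : V) :
    Module.finrank k (space M v) = Module.finrank k (space N v) :=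
  LinearEquiv.finrank_eq (LinearEquiv.ofLinearMap (component e.hom v) (component e.inv v)
    (by rw [← component_comp, e.inv_hom_id, component_id])
    (by rw [← component_comp, e.hom_inv_id, component_id]))

theorem exists_space_nontrivial_of_not_isZero {M : QuiverRep k V} (hM : ¬ IsZero M) :
    ∃ v, Nontrivial (space M v) := by
  by_contra! h
  exact hM ((IsZero.iff_id_eq_zero M).2
    (hom_ext_component fun v x => (h v).elim _ _))

theorem component_injective_of_mono {M N : QuiverRep k V} (f : M ⟶ N) [Mono f] (v : V) :
    Function.Injective (component f v) := by
  have : Mono (f.app ((Paths.of V).obj v)) := (NatTrans.mono_iff_mono_app f).1 inferInstance _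
  exact (ModuleCat.mono_iff_injective
    ((forget₂ (FGModuleCat k) (ModuleCat k)).map (f.app ((Paths.of V).obj v)))).1 inferInstance

theorem component_surjective_of_epi {M N : QuiverRep k V} (f : M ⟶ N) [Epi f] (v : V) :
    Function.Surjective (component f v) := by
  have : Epi (f.app ((Paths.of V).obj v)) := (NatTrans.epi_iff_epi_app f).1 inferInstance _
  exact (ModuleCat.epi_iff_surjective
    ((forget₂ (FGModuleCat k) (ModuleCat k)).map (f.app ((Paths.of V).obj v)))).1 inferInstance

theorem component_exact {S : ShortComplex (QuiverRep k V)} (hS : S.ShortExact) (v : V) :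
    Function.Exact (component S.f v) (component S.g v) :=
  (ShortComplex.ShortExact.moduleCat_exact_iff_function_exact _).1
    ((hS.map_of_exact ((evaluation _ _).obj ((Paths.of V).obj v))).map_of_exact
      (forget₂ (FGModuleCat k) (ModuleCat k))).exact

theorem shortExact_of_component {M N L : QuiverRep k V} (f : M ⟶ N) (g : N ⟶ L) (w : f ≫ g = 0)
    (hf : ∀ v, Function.Injective (component f v)) (hg : ∀ v, Function.Surjective (component g v))
    (hfg : ∀ v y, component g v y = 0 → ∃ x, component f v x = y) :
    (ShortComplex.mk f g w).ShortExact := by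
  have hm : Mono f := ⟨fun a b h => hom_ext_component fun v x => hf v <| by
    rw [component_component_of_comp_eq h, component_component_of_comp_eq rfl]⟩
  have he : Epi g := ⟨fun a b h => hom_ext_component fun v x => by
    obtain ⟨y, rfl⟩ := hg v x
    rw [component_component_of_comp_eq h, component_component_of_comp_eq rfl]⟩
  refine { exact := ?_, mono_f := hm, epi_g := he }
  refine ShortComplex.exact_of_f_is_kernel _ (KernelFork.IsLimit.ofι' f w fun {X} t ht => ?_)
  have hlift : ∀ v (x : space X v), ∃ y, component f v y = component t v x := fun v x =>
    hfg v _ (component_component_of_comp_eq ht v x)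
  choose s hs using hlift
  refine ⟨homMk (fun v => { toFun := s v, map_add' := fun x y => hf v ?_,
                            map_smul' := fun c x => hf v ?_ }) fun {a b} α x => hf b ?_,
    hom_ext_component hs⟩
  · simp [hs]
  · simp [hs]
  · change component f b (s b _) = component f b (arrowMap M α (s a x))
    rw [hs, component_arrowMap, component_arrowMap, hs]

theorem finrank_space_of_shortExact {S : ShortComplex (QuiverRep k V)} (hS : S.ShortExact)
    (v : V) : Module.finrank k (space S.X₂ v) =
      Module.finrank k (space S.X₁ v) + Module.finrank k (space S.X₃ v) := by
  have := hS.mono_f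
  have := hS.epi_g
  rw [← (component S.g v).finrank_range_add_finrank_ker, (component_exact hS v).linearMap_ker_eq,
    LinearMap.finrank_range_of_inj (component_injective_of_mono S.f v),
    LinearMap.range_eq_top.2 (component_surjective_of_epi S.g v), finrank_top, add_comm]

/-- The differential of the two-term complex of Hom spaces at the vertices and along the arrows,
whose cokernel is `Ext¹(A, B)`. -/
def coboundary (A B : QuiverRep k V) (h : ∀ v : V, space A v →ₗ[k] space B v) :
    ∀ ⦃a b : V⦄, (a ⟶ b) → (space A a →ₗ[k] space B b) :=
  fun a b α => h b ∘ₗ arrowMap A α - arrowMap B α ∘ₗ h a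

theorem exists_section_of_surjective_coboundary {A B : QuiverRep k V}
    (h : Function.Surjective (coboundary A B)) {E : QuiverRep k V} {f : B ⟶ E} {g : E ⟶ A}
    {w : f ≫ g = 0} (hS : (ShortComplex.mk f g w).ShortExact) : ∃ s : A ⟶ E, s ≫ g = 𝟙 A := by
  have := hS.mono_f
  have := hS.epi_g
  have hσ : ∀ v, ∃ σ : space A v →ₗ[k] space E v, component g v ∘ₗ σ = LinearMap.id := fun v =>
    (component g v).exists_rightInverse_of_surjective
      (LinearMap.range_eq_top.2 (component_surjective_of_epi g v))
  have hρ : ∀ v, ∃ ρ : space E v →ₗ[k] space B v, ρ ∘ₗ component f v = LinearMap.id := fun v =>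
    (component f v).exists_leftInverse_of_injective
      (LinearMap.ker_eq_bot.2 (component_injective_of_mono f v))
  choose σ hσ using hσ
  choose ρ hρ using hρ
  have hσ' : ∀ v x, component g v (σ v x) = x := fun v => LinearMap.congr_fun (hσ v)
  have hfρ : ∀ v y, component g v y = 0 → component f v (ρ v y) = y := fun v y hy => by
    obtain ⟨x, rfl⟩ := (component_exact hS v y).1 hy
    exact congrArg _ (LinearMap.congr_fun (hρ v) x)
  obtain ⟨η, hη⟩ := h fun a b α => ρ b ∘ₗ (arrowMap E α ∘ₗ σ a - σ b ∘ₗ arrowMap A α)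
  have hdefect : ∀ {a b : V} (α : a ⟶ b) (x : space A a),
      component f b (η b (arrowMap A α x)) - arrowMap E α (component f a (η a x)) =
        arrowMap E α (σ a x) - σ b (arrowMap A α x) := fun {a b} α x => by
    rw [← component_arrowMap, ← map_sub,
      ← hfρ b (arrowMap E α (σ a x) - σ b (arrowMap A α x))
        (by rw [map_sub, component_arrowMap, hσ', hσ', sub_self])]
    exact congrArg _ (LinearMap.congr_fun (congrFun (congrFun (congrFun hη a) b) α) x)
  refine ⟨homMk (fun v => σ v + component f v ∘ₗ η v) fun {a b} α x => ?_,
    hom_ext_component fun v x => ?_⟩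
  · simp only [LinearMap.add_apply, LinearMap.comp_apply, map_add]
    rw [add_comm]
    exact sub_eq_sub_iff_add_eq_add.1 (hdefect α x)
  · simp [hσ', component_component_of_comp_eq w]

/-- The extension of `A` by `B` glued along a cochain `c`. -/
def cochainExtension {A B : QuiverRep k V}
    (c : ∀ ⦃a b : V⦄, (a ⟶ b) → (space A a →ₗ[k] space B b)) : QuiverRep k V :=
  Paths.lift
    { obj := fun v => FGModuleCat.of k (space B v × space A v)
      map := fun {_ _} α => FGModuleCat.ofHom
        ((LinearMap.coprod (arrowMap B α) (c α)).prod (arrowMap A α ∘ₗ LinearMap.snd k _ _)) }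

theorem mem_range_coboundary_of_subsingleton_ext_one [HasExt (QuiverRep k V)]
    {A B : QuiverRep k V} [Subsingleton (Abelian.Ext A B 1)]
    (c : ∀ ⦃a b : V⦄, (a ⟶ b) → (space A a →ₗ[k] space B b)) :
    ∃ h, coboundary A B h = c := by
  let f : B ⟶ cochainExtension c :=
    homMk (fun v => LinearMap.inl k (space B v) (space A v)) fun {a b} α x => by
      change (arrowMap B α x, (0 : space A b)) = (arrowMap B α x + c α 0, arrowMap A α 0)
      simp
  let g : cochainExtension c ⟶ A :=
    homMk (fun v => LinearMap.snd k (space B v) (space A v)) fun _ _ => rfl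
  have hS : (ShortComplex.mk f g (hom_ext_component fun v x => rfl)).ShortExact :=
    shortExact_of_component _ _ _ (fun _ _ _ h => congrArg Prod.fst h)
      (fun v x => ⟨((0 : space B v), x), rfl⟩) fun v y hy => ⟨y.1, Prod.ext rfl (Eq.symm hy)⟩
  obtain ⟨s, hs⟩ := exists_section_of_extClass_eq_zero hS (Subsingleton.elim _ _)
  have hs' : ∀ v x, (show space B v × space A v from component s v x).2 = x :=
    component_component_of_comp_eq hs
  refine ⟨fun v => LinearMap.fst k (space B v) (space A v) ∘ₗ component s v, ?_⟩
  funext a b α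
  ext x
  have hfst : (show space B b × space A b from component s b (arrowMap A α x)).1 =
      arrowMap B α (show space B a × space A a from component s a x).1 +
        c α (show space B a × space A a from component s a x).2 :=
    congrArg (fun t : space B b × space A b => t.1) (component_arrowMap s α x)
  rw [hs'] at hfst
  exact sub_eq_of_eq_add' hfst

theorem subsingleton_ext_one_iff_surjective_coboundary [HasExt (QuiverRep k V)]
    {A B : QuiverRep k V} :
    Subsingleton (Abelian.Ext A B 1) ↔ Function.Surjective (coboundary A B) :=
  ⟨fun _ => mem_range_coboundary_of_subsingleton_ext_one, fun h =>
    subsingleton_ext_one_iff_forall_exists_section.2 fun _ _ _ _ hS =>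
      exists_section_of_surjective_coboundary h hS⟩

end Representations

/-! ### Interval representations and their extensions -/

section Arrows

variable {n : ℕ} {ε : Fin (n + 1) → Bool}

/-- The vertex `m` of the polygon lies above the horizontal line, that is, the edge of the quiver
between the vertices of index `m - 1` and `m` points to the right. -/
def IsUpper (ε : Fin (n + 1) → Bool) (m : ℕ) : Prop := ∃ e : Fin (n + 1), e.val + 1 = m ∧ ε e = true

theorem isUpper_succ_iff (e : Fin (n + 1)) : IsUpper ε (e.val + 1) ↔ ε e = true :=
  ⟨fun ⟨_, h, he⟩ => Fin.ext (Nat.succ_injective h) ▸ he, fun he => ⟨e, rfl, he⟩⟩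

theorem val_of_arrow {a b : Vertex ε} (α : a ⟶ b) :
    (a.val + 1 = b.val ∧ IsUpper ε b.val) ∨ (b.val + 1 = a.val ∧ ¬ IsUpper ε a.val) := by
  match a, b, α with
  | _, _, Arrow.right e he => exact Or.inl ⟨rfl, (isUpper_succ_iff e).2 he⟩
  | _, _, Arrow.left e he => exact Or.inr ⟨rfl, fun h => by simp [(isUpper_succ_iff e).1 h] at he⟩

theorem nonempty_arrow_of_isUpper {a b : Vertex ε} (hab : a.val + 1 = b.val)
    (h : IsUpper ε b.val) : Nonempty (a ⟶ b) := by
  obtain ⟨e, he, hε⟩ := h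
  obtain rfl : a = e.castSucc := Fin.ext (by rw [Fin.val_castSucc]; omega)
  obtain rfl : b = e.succ := Fin.ext he.symm
  exact ⟨Arrow.right e hε⟩

theorem nonempty_arrow_of_not_isUpper {a b : Vertex ε} (hab : b.val + 1 = a.val)
    (h : ¬ IsUpper ε a.val) : Nonempty (a ⟶ b) := by
  obtain ⟨e, he⟩ : ∃ e : Fin (n + 1), e.val + 1 = a.val :=
    ⟨⟨b.val, by have := a.isLt; omega⟩, hab⟩
  obtain rfl : a = e.succ := Fin.ext he.symm
  obtain rfl : b = e.castSucc := Fin.ext (Nat.succ_injective hab)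
  exact ⟨Arrow.left e (Bool.eq_false_iff.2 fun hε => h ⟨e, he, hε⟩)⟩

theorem exists_primitive {k : Type*} [AddCommGroup k] (f : ∀ ⦃a b : Vertex ε⦄, (a ⟶ b) → k) :
    ∃ H : Vertex ε → k, ∀ ⦃a b⦄ (α : a ⟶ b), f α = H b - H a := by
  let d (e : Fin (n + 1)) : k := if h : ε e = true then f (Arrow.right e h) else
    -f (Arrow.left e (Bool.eq_false_iff.2 h))
  refine ⟨Fin.partialSum d, fun a b α => ?_⟩
  match a, b, α with
  | _, _, Arrow.right e he => simp [Fin.partialSum_succ, d, he]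
  | _, _, Arrow.left e he => simp [Fin.partialSum_succ, d, he]

theorem eq_of_forall_arrow {X : Type*} (G : Vertex ε → X) {s t : Vertex ε} (hst : s.val ≤ t.val)
    (h : ∀ ⦃a b : Vertex ε⦄, (a ⟶ b) → s.val ≤ a.val → a.val ≤ t.val → s.val ≤ b.val →
      b.val ≤ t.val → G a = G b) : G s = G t := by
  suffices ∀ m, s.val ≤ m → ∀ hm : m ≤ t.val, G s = G ⟨m, hm.trans_lt t.isLt⟩ from
    this t.val hst le_rfl
  intro m hsm
  induction m, hsm using Nat.le_induction with
  | base => exact fun _ => rfl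
  | succ m hsm ih =>
    intro hm
    rw [ih (by omega)]
    let a : Vertex ε := ⟨m, by omega⟩
    let b : Vertex ε := ⟨m + 1, by omega⟩
    have hG : ∀ {x y : Vertex ε}, (x ⟶ y) → (x = a ∧ y = b ∨ x = b ∧ y = a) → G x = G y := by
      rintro x y α (⟨rfl, rfl⟩ | ⟨rfl, rfl⟩) <;>
        exact h α (by grind) (by grind) (by grind) (by grind)
    by_cases hu : IsUpper ε (m + 1)
    · exact hG (nonempty_arrow_of_isUpper (a := a) (b := b) rfl hu).some (Or.inl ⟨rfl, rfl⟩)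
    · exact (hG (nonempty_arrow_of_not_isUpper (a := b) (b := a) rfl hu).some
        (Or.inr ⟨rfl, rfl⟩)).symm

end Arrows

section Intervals

variable {k : Type u} [Field k] {n : ℕ} {ε : Fin (n + 1) → Bool} {i j i' j' : ℕ}

/-- The vertex of index `m` lies in the support of the interval representation of `[i, j)`. -/
abbrev Inside (i j m : ℕ) : Prop := i ≤ m ∧ m < j

/-- The standard vector of an interval representation at a vertex, which is zero off the
interval. -/
def unitVec (i j : ℕ) (v : Vertex ε) : space (interval k ε i j) v :=
  fun _ : PLift (Inside i j v.val) => (1 : k)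

open scoped Classical in
/-- The coordinate of a vector of an interval representation with respect to `unitVec`, which is
zero off the interval. -/
def coord (i j : ℕ) (v : Vertex ε) : space (interval k ε i j) v →ₗ[k] k :=
  if h : Inside i j v.val then (LinearMap.proj ⟨h⟩ : (PLift (Inside i j v.val) → k) →ₗ[k] k) else 0

theorem coord_apply {v : Vertex ε} (h : Inside i j v.val) (x : space (interval k ε i j) v) :
    coord i j v x = (x : PLift (Inside i j v.val) → k) ⟨h⟩ :=
  congrArg (fun f : space (interval k ε i j) v →ₗ[k] k => f x) (dif_pos h)

theorem coord_unitVec {v : Vertex ε} (h : Inside i j v.val) :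
    coord i j v (unitVec (k := k) i j v) = 1 :=
  coord_apply h _

theorem coord_eq_zero {v : Vertex ε} (h : ¬ Inside i j v.val) :
    coord (k := k) i j v = 0 :=
  dif_neg h

theorem space_interval_ext {v : Vertex ε} {x y : space (interval k ε i j) v}
    (h : Inside i j v.val → coord i j v x = coord i j v y) : x = y :=
  funext fun t : PLift (Inside i j v.val) =>
    (coord_apply t.down x).symm.trans ((h t.down).trans (coord_apply t.down y))

theorem unitVec_eq_zero {v : Vertex ε} (h : ¬ Inside i j v.val) :
    unitVec (k := k) i j v = 0 :=
  space_interval_ext fun h' => absurd h' h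

theorem coord_smul_unitVec {v : Vertex ε} (x : space (interval k ε i j) v) :
    coord i j v x • unitVec i j v = x :=
  space_interval_ext fun h => by rw [map_smul, coord_unitVec h, smul_eq_mul, mul_one]

theorem linearMap_interval_ext {v : Vertex ε} {X : Type*} [AddCommGroup X] [Module k X]
    {f g : space (interval k ε i j) v →ₗ[k] X}
    (h : Inside i j v.val → f (unitVec i j v) = g (unitVec i j v)) : f = g := by
  ext x
  rw [← coord_smul_unitVec x, map_smul, map_smul]
  by_cases hv : Inside i j v.val
  · rw [h hv]
  · rw [unitVec_eq_zero hv, map_zero, map_zero]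

theorem coord_arrowMap {a b : Vertex ε} (α : a ⟶ b) (hb : Inside i j b.val)
    (x : space (interval k ε i j) a) : coord i j b (arrowMap _ α x) = coord i j a x := by
  rw [coord_apply hb]
  change indicatorMap k (Inside i j a.val) _ x ⟨hb⟩ = _
  by_cases ha : Inside i j a.val
  · rw [coord_apply ha, indicatorMap, dif_pos ha]
    rfl
  · rw [coord_eq_zero ha, indicatorMap, dif_neg ha]
    rfl

theorem arrowMap_unitVec {a b : Vertex ε} (α : a ⟶ b) (ha : Inside i j a.val) :
    arrowMap (interval k ε i j) α (unitVec i j a) = unitVec i j b :=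
  space_interval_ext fun hb => by rw [coord_arrowMap α hb, coord_unitVec ha, coord_unitVec hb]

open scoped Classical in
theorem finrank_space_interval (v : Vertex ε) :
    Module.finrank k (space (interval k ε i j) v) = if Inside i j v.val then 1 else 0 := by
  split_ifs with h
  · exact (LinearEquiv.ofLinearMap (coord i j v) (LinearMap.toSpanSingleton k _ (unitVec i j v))
      (by ext; simp [coord_unitVec h])
      (LinearMap.ext coord_smul_unitVec)).finrank_eq.trans (Module.finrank_self k)
  · have : Subsingleton (space (interval k ε i j) v) :=
      ⟨fun x y => space_interval_ext fun h' => absurd h' h⟩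
    exact Module.finrank_zero_of_subsingleton

theorem coord_coboundary_unitVec
    (h : ∀ v, space (interval k ε i j) v →ₗ[k] space (interval k ε i' j') v)
    {a b : Vertex ε} (α : a ⟶ b) (ha : Inside i j a.val) (hb : Inside i' j' b.val) :
    coord i' j' b (coboundary _ _ h α (unitVec i j a)) =
      coord i' j' b (h b (unitVec i j b)) - coord i' j' a (h a (unitVec i j a)) := by
  simp only [coboundary, LinearMap.sub_apply, LinearMap.comp_apply, map_sub, arrowMap_unitVec α ha,
    coord_arrowMap α hb]

theorem subsingleton_ext_one_interval_iff :
    Subsingleton (Abelian.Ext (interval k ε i j) (interval k ε i' j') 1) ↔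
      ∀ f : ∀ ⦃a b : Vertex ε⦄, (a ⟶ b) → k, ∃ η : Vertex ε → k,
        (∀ v, ¬ (Inside i j v.val ∧ Inside i' j' v.val) → η v = 0) ∧
        ∀ ⦃a b : Vertex ε⦄ (α : a ⟶ b), Inside i j a.val → Inside i' j' b.val →
          f α = η b - η a := by
  rw [subsingleton_ext_one_iff_surjective_coboundary]
  constructor
  · intro hsurj f
    obtain ⟨h, hh⟩ := hsurj fun a b α =>
      LinearMap.toSpanSingleton k _ (f α • unitVec i' j' b) ∘ₗ coord i j a
    refine ⟨fun v => coord i' j' v (h v (unitVec i j v)), fun v hv => ?_, fun a b α ha hb => ?_⟩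
    · rcases not_and_or.1 hv with hv | hv
      · simp only [unitVec_eq_zero hv, map_zero]
      · simp only [coord_eq_zero hv, LinearMap.zero_apply]
    · rw [← coord_coboundary_unitVec h α ha hb, hh]
      simp [coord_unitVec ha, coord_unitVec hb]
  · intro hf c
    obtain ⟨η, hη, hη'⟩ := hf fun a b α => coord i' j' b (c α (unitVec i j a))
    let h (v : Vertex ε) : space (interval k ε i j) v →ₗ[k] space (interval k ε i' j') v :=
      LinearMap.toSpanSingleton k _ (η v • unitVec i' j' v) ∘ₗ coord i j v
    have hcoord : ∀ v, coord i' j' v (h v (unitVec i j v)) = η v := fun v => by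
      by_cases hv : Inside i j v.val ∧ Inside i' j' v.val
      · simp [h, coord_unitVec hv.1, coord_unitVec hv.2]
      · simp [h, hη v hv]
    refine ⟨h, funext fun a => funext fun b => funext fun α => ?_⟩
    refine linearMap_interval_ext fun ha => space_interval_ext fun hb => ?_
    rw [coord_coboundary_unitVec h α ha hb, hcoord, hcoord, hη' α ha hb]

theorem subsingleton_ext_one_interval (x : ℕ)
    (h : ∀ ⦃a b : Vertex ε⦄, (a ⟶ b) → Inside i j a.val → Inside i' j' b.val →
      (¬ Inside i' j' a.val → a.val = x) ∧ (¬ Inside i j b.val → b.val = x)) :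
    Subsingleton (Abelian.Ext (interval k ε i j) (interval k ε i' j') 1) := by
  classical
  refine subsingleton_ext_one_interval_iff.2 fun f => ?_
  obtain ⟨H, hH⟩ := exists_primitive f
  obtain ⟨c, hc⟩ : ∃ c, ∀ v : Vertex ε, v.val = x → H v = c := by
    by_cases hx : x < n + 2
    · exact ⟨H ⟨x, hx⟩, fun v hv => congrArg H (Fin.ext hv)⟩
    · exact ⟨0, fun v hv => absurd (hv ▸ v.isLt) hx⟩
  let η (v : Vertex ε) : k := if Inside i j v.val ∧ Inside i' j' v.val then H v - c else 0
  refine ⟨η, fun v hv => if_neg hv, fun a b α ha hb => ?_⟩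
  obtain ⟨hax, hbx⟩ := h α ha hb
  have hηa : η a = H a - c :=
    ite_eq_left_iff.2 fun h' => by rw [hc a (hax fun ha' => h' ⟨ha, ha'⟩), sub_self]
  have hηb : η b = H b - c :=
    ite_eq_left_iff.2 fun h' => by rw [hc b (hbx fun hb' => h' ⟨hb', hb⟩), sub_self]
  rw [hηa, hηb, hH α, sub_sub_sub_cancel_right]

theorem not_subsingleton_ext_one_interval {s t : Vertex ε} (hst : s.val < t.val)
    (h : ∀ ⦃a b : Vertex ε⦄, (a ⟶ b) → s.val ≤ a.val → a.val ≤ t.val → s.val ≤ b.val →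
      b.val ≤ t.val → Inside i j a.val ∧ Inside i' j' b.val)
    (hs : ¬ (Inside i j s.val ∧ Inside i' j' s.val))
    (ht : ¬ (Inside i j t.val ∧ Inside i' j' t.val)) :
    ¬ Subsingleton (Abelian.Ext (interval k ε i j) (interval k ε i' j') 1) := by
  intro hsub
  let χ (v : Vertex ε) : k := if s.val < v.val then 1 else 0
  obtain ⟨η, hη, hη'⟩ := subsingleton_ext_one_interval_iff.1 hsub fun a b _ => χ b - χ a
  have hconst : η s - χ s = η t - χ t :=
    eq_of_forall_arrow (fun v => η v - χ v) hst.le fun a b α has hat hbs hbt => by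
      obtain ⟨ha, hb⟩ := h α has hat hbs hbt
      linear_combination hη' α ha hb
  rw [hη s hs, hη t ht] at hconst
  simp [χ, hst] at hconst

theorem isBrick_interval (hij : i < j) (hj : j ≤ n + 2) : IsBrick k (interval k ε i j) where
  not_isZero h := by
    let v : Vertex ε := ⟨i, by omega⟩
    have hv : unitVec (k := k) i j v = 0 :=
      congrArg (fun φ => component φ v (unitVec i j v)) (h.eq_of_src (𝟙 (interval k ε i j)) 0)
    have hcoord := coord_unitVec (k := k) (i := i) (j := j) (v := v) ⟨le_rfl, hij⟩
    rw [hv, map_zero] at hcoord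
    exact zero_ne_one hcoord
  exists_eq_smul_id φ := by
    let η (v : Vertex ε) : k := coord i j v (component φ v (unitVec i j v))
    have hη : ∀ v : Vertex ε, Inside i j v.val → η ⟨i, by omega⟩ = η v := fun v hv =>
      eq_of_forall_arrow η hv.1 fun a b α has hat hbs hbt => by
        have ha : Inside i j a.val := ⟨has, hat.trans_lt hv.2⟩
        have hb : Inside i j b.val := ⟨hbs, hbt.trans_lt hv.2⟩
        simp only [η]
        rw [← arrowMap_unitVec α ha, component_arrowMap, coord_arrowMap α hb]
    refine ⟨η ⟨i, by omega⟩, hom_ext_component fun v => LinearMap.congr_fun ?_⟩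
    refine linearMap_interval_ext fun hv => space_interval_ext fun _ => ?_
    simp only [component_smul, component_id, LinearMap.smul_apply, LinearMap.id_apply, map_smul,
      coord_unitVec hv, smul_eq_mul, mul_one]
    exact (hη v hv).symm

theorem exists_intervalHom (h : ∀ ⦃a b : Vertex ε⦄, (a ⟶ b) → Inside i j a.val →
      Inside i' j' b.val → (Inside i j b.val ↔ Inside i' j' a.val)) :
    ∃ φ : interval k ε i j ⟶ interval k ε i' j', ∀ v, Inside i' j' v.val →
      ∀ x, coord i' j' v (component φ v x) = coord i j v x := by
  refine ⟨homMk (fun v => LinearMap.toSpanSingleton k _ (unitVec i' j' v) ∘ₗ coord i j v)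
    fun {a b} α x => space_interval_ext fun hb => ?_, fun v hv x => ?_⟩
  · rw [coord_arrowMap α hb]
    simp only [LinearMap.comp_apply, LinearMap.toSpanSingleton_apply, map_smul, coord_unitVec hb]
    by_cases ha : Inside i j a.val
    · by_cases hb' : Inside i j b.val
      · rw [coord_arrowMap α hb', coord_unitVec ((h α ha hb).1 hb')]
      · have ha' : ¬ Inside i' j' a.val := fun ha' => hb' ((h α ha hb).2 ha')
        rw [coord_eq_zero hb', coord_eq_zero ha', LinearMap.zero_apply, LinearMap.zero_apply,
          zero_smul, smul_zero]
    · rw [← coord_smul_unitVec x, unitVec_eq_zero ha, smul_zero, map_zero, map_zero, map_zero,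
        zero_smul, zero_smul]
  · change coord i' j' v (coord i j v x • unitVec (k := k) i' j' v) = _
    rw [map_smul, coord_unitVec hv, smul_eq_mul, mul_one]

theorem exists_shortExact_interval {a b : ℕ}
    (hunion : ∀ v, Inside a b v ↔ Inside i j v ∨ Inside i' j' v)
    (hdisj : ∀ v, ¬ (Inside i j v ∧ Inside i' j' v))
    (hα : ∀ ⦃x y : Vertex ε⦄, (x ⟶ y) → ¬ (Inside i' j' x.val ∧ Inside i j y.val)) :
    ∃ (f : interval k ε i' j' ⟶ interval k ε a b) (g : interval k ε a b ⟶ interval k ε i j)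
      (w : f ≫ g = 0), (ShortComplex.mk f g w).ShortExact := by
  obtain ⟨f, hf⟩ : ∃ f : interval k ε i' j' ⟶ interval k ε a b, ∀ v, Inside a b v.val →
      ∀ x, coord a b v (component f v x) = coord i' j' v x :=
    exists_intervalHom fun x y α hx hy => by
      have := hα α
      grind
  obtain ⟨g, hg⟩ : ∃ g : interval k ε a b ⟶ interval k ε i j, ∀ v, Inside i j v.val →
      ∀ x, coord i j v (component g v x) = coord a b v x :=
    exists_intervalHom fun x y α hx hy => by
      have := hα α
      grind
  have w : f ≫ g = 0 := hom_ext_component fun v x => space_interval_ext fun hv => by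
    rw [component_comp, LinearMap.comp_apply, hg v hv, hf v ((hunion v.val).2 (Or.inl hv)),
      coord_eq_zero fun hv' => hdisj v.val ⟨hv, hv'⟩, component_zero, LinearMap.zero_apply,
      LinearMap.zero_apply, map_zero]
  refine ⟨f, g, w, shortExact_of_component f g w (fun v x y hxy => ?_) (fun v x => ?_)
    fun v y hy => ?_⟩
  · refine space_interval_ext fun hv => ?_
    have hv' := (hunion v.val).2 (Or.inr hv)
    rw [← hf v hv', hxy, hf v hv']
  · refine ⟨coord i j v x • unitVec a b v, space_interval_ext fun hv => ?_⟩
    rw [hg v hv, map_smul, coord_unitVec ((hunion v.val).2 (Or.inl hv)), smul_eq_mul, mul_one]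
  · refine ⟨coord a b v y • unitVec i' j' v, space_interval_ext fun hv => ?_⟩
    rw [hf v hv, map_smul, smul_eq_mul]
    rcases (hunion v.val).1 hv with hv' | hv'
    · rw [← hg v hv', hy, map_zero, zero_mul]
    · rw [coord_unitVec hv', mul_one]

end Intervals

section Combinatorics

variable {k : Type u} [Field k] {n : ℕ} {ε : Fin (n + 1) → Bool} {i j i' j' : ℕ}

/-- To the right of both left endpoints, a line segment of the polygon starting at the vertex `i`
begins below one starting at the vertex `i'`. -/
def StartsBelow (ε : Fin (n + 1) → Bool) (i i' : ℕ) : Prop :=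
  i < i' ∧ IsUpper ε i' ∨ i' < i ∧ ¬ IsUpper ε i

/-- To the left of both right endpoints, a line segment of the polygon ending at the vertex `j`
finishes above one ending at the vertex `j'`. -/
def EndsAbove (ε : Fin (n + 1) → Bool) (j j' : ℕ) : Prop :=
  j < j' ∧ IsUpper ε j ∨ j' < j ∧ ¬ IsUpper ε j'

/-- `Ext¹` between the interval representations of `[i, j)` and `[i', j')` does not vanish. -/
def HasExtension (ε : Fin (n + 1) → Bool) (i j i' j' : ℕ) : Prop :=
  StartsBelow ε i i' ∧ EndsAbove ε j j' ∧ max i i' ≤ min j j'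

/-- The line segment `γ` crosses the line segment `δ` from below to above when it is traversed from
left to right. -/
def CrossesUpward (ε : Fin (n + 1) → Bool) (γ δ : LineSegment n) : Prop :=
  StartsBelow ε γ.i δ.i ∧ EndsAbove ε γ.j δ.j ∧ max γ.i.val δ.i.val < min γ.j.val δ.j.val

theorem subsingleton_ext_one_of_not_hasExtension (hij : i < j) (hij' : i' < j')
    (h : ¬ HasExtension ε i j i' j') :
    Subsingleton (Abelian.Ext (interval k ε i j) (interval k ε i' j') 1) := by
  classical
  refine subsingleton_ext_one_interval (if StartsBelow ε i i' then max i i' - 1 else min j j')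
    fun a b α ha hb => ?_
  have hα := val_of_arrow α
  unfold HasExtension EndsAbove at h
  unfold StartsBelow at *
  grind

theorem not_subsingleton_ext_one_of_hasExtension (hij : i < j) (hj : j ≤ n + 2) (hij' : i' < j')
    (hj' : j' ≤ n + 2) (h : HasExtension ε i j i' j') :
    ¬ Subsingleton (Abelian.Ext (interval k ε i j) (interval k ε i' j') 1) := by
  obtain ⟨hstart, hend, hle⟩ := h
  unfold StartsBelow at hstart
  unfold EndsAbove at hend
  refine not_subsingleton_ext_one_interval (s := ⟨max i i' - 1, by omega⟩)
    (t := ⟨min j j', by omega⟩) (show max i i' - 1 < min j j' by omega)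
    (fun a b α has hat hbs hbt => ?_) (by grind) (by grind)
  have hα := val_of_arrow α
  grind

theorem extGeneratedByIndec_of_shortExact {A B E : RepQ k ε} {f : B ⟶ E} {g : E ⟶ A}
    {w : f ≫ g = 0} (hS : (ShortComplex.mk f g w).ShortExact) (hB : IsBrick k B)
    (hE : Indecomposable E) (hEB : Subsingleton (Abelian.Ext E B 1))
    (hAB : ¬ Subsingleton (Abelian.Ext A B 1)) : ExtGeneratedByIndec A B := by
  have hspan : Submodule.span k {(hS.extClass : Abelian.Ext A B 1)} = ⊤ :=
    IsBrick.span_extClass_eq_top hS hB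
  refine ⟨(finrank_eq_one_iff_of_nonzero _ fun h0 => hAB ?_).2 hspan, E, f, g, w, hS, hspan, hE⟩
  rw [h0, Submodule.span_zero_singleton] at hspan
  exact (Submodule.subsingleton_iff k).1 (subsingleton_of_bot_eq_top hspan)

theorem extGeneratedByIndec_interval (hij : i < j) (hj : j ≤ n + 2) (hij' : i' < j')
    (hj' : j' ≤ n + 2) (h : HasExtension ε i j i' j') (htouch : max i i' = min j j') :
    ExtGeneratedByIndec (interval k ε i j) (interval k ε i' j') := by
  have hE : ¬ HasExtension ε (min i i') (max j j') i' j' := by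
    unfold HasExtension StartsBelow EndsAbove at *
    grind
  obtain ⟨f, g, w, hS⟩ := exists_shortExact_interval (k := k) (ε := ε) (i := i) (j := j) (i' := i')
    (j' := j') (a := min i i') (b := max j j') (fun v => by grind) (fun v => by grind)
    fun x y α hxy => by
      have hα := val_of_arrow α
      unfold HasExtension StartsBelow EndsAbove at *
      grind
  exact extGeneratedByIndec_of_shortExact hS (isBrick_interval hij' hj')
    (isBrick_interval (by omega) (by omega)).indecomposable
    (subsingleton_ext_one_of_not_hasExtension (by omega) hij' hE)
    (not_subsingleton_ext_one_of_hasExtension hij hj hij' hj' h)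

end Combinatorics

/-! ### Classification of the indecomposable representations -/

section Classification

variable {k : Type u} [Field k] {n : ℕ} {ε : Fin (n + 1) → Bool} {M : RepQ k ε}

theorem heq_of_arrow {a b c d : Vertex ε} (α : a ⟶ b) (β : c ⟶ d) (hac : a = c) (hbd : b = d) :
    α ≍ β := by
  match a, b, α, c, d, β with
  | _, _, Arrow.right e _, _, _, Arrow.right e' _ =>
    obtain rfl := Fin.castSucc_injective _ hac
    rfl
  | _, _, Arrow.left e _, _, _, Arrow.left e' _ =>
    obtain rfl := Fin.succ_injective _ hac
    rfl
  | _, _, Arrow.right e _, _, _, Arrow.left e' _ =>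
    have := congrArg Fin.val hac
    have := congrArg Fin.val hbd
    grind
  | _, _, Arrow.left e _, _, _, Arrow.right e' _ =>
    have := congrArg Fin.val hac
    have := congrArg Fin.val hbd
    grind

theorem unique_arrow_or_unique_arrow {a b : Vertex ε} (hab : a.val + 1 = b.val) :
    Nonempty (Unique (a ⟶ b)) ∧ IsEmpty (b ⟶ a) ∨
      IsEmpty (a ⟶ b) ∧ Nonempty (Unique (b ⟶ a)) := by
  by_cases h : IsUpper ε b.val
  · exact Or.inl ⟨⟨⟨⟨(nonempty_arrow_of_isUpper hab h).some⟩, fun α =>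
      eq_of_heq (heq_of_arrow _ _ rfl rfl)⟩⟩, ⟨fun α => by grind [val_of_arrow α]⟩⟩
  · exact Or.inr ⟨⟨fun α => by grind [val_of_arrow α]⟩,
      ⟨⟨⟨(nonempty_arrow_of_not_isUpper hab h).some⟩, fun α =>
        eq_of_heq (heq_of_arrow _ _ rfl rfl)⟩⟩⟩

/-- The families of vectors over the vertices of `[i, j)` which are preserved by all arrows between
these vertices. -/
def sections (M : RepQ k ε) (i j : ℕ) : Submodule k (∀ v, space M v) where
  carrier := {x | ∀ ⦃a b : Vertex ε⦄ (α : a ⟶ b), Inside i j a.val → Inside i j b.val →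
    arrowMap M α (x a) = x b}
  add_mem' hx hy _ _ α ha hb := by
    rw [Pi.add_apply, map_add, hx α ha hb, hy α ha hb, Pi.add_apply]
  zero_mem' _ _ α _ _ := map_zero (arrowMap M α)
  smul_mem' c _ hx _ _ α ha hb := by rw [Pi.smul_apply, map_smul, hx α ha hb, Pi.smul_apply]

/-- A family of linear forms on the spaces of `M` which is preserved by all arrows between vertices
of `[i, j)`, contravariantly. -/
def IsDualSection (M : RepQ k ε) (i j : ℕ) (φ : ∀ v, Module.Dual k (space M v)) : Prop :=
  ∀ ⦃a b : Vertex ε⦄ (α : a ⟶ b), Inside i j a.val → Inside i j b.val →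
    φ b ∘ₗ arrowMap M α = φ a

theorem sections_anti {i j j' : ℕ} (h : j ≤ j') : sections M i j' ≤ sections M i j :=
  fun _ hx _ _ α ha hb => hx α ⟨ha.1, ha.2.trans_le h⟩ ⟨hb.1, hb.2.trans_le h⟩

theorem exists_intervalHom_of_mem_sections {i j : ℕ} {x : ∀ v, space M v}
    (hx : x ∈ sections M i j)
    (hout : ∀ ⦃a b : Vertex ε⦄ (α : a ⟶ b), Inside i j a.val → ¬ Inside i j b.val →
      arrowMap M α (x a) = 0) :
    ∃ f : interval k ε i j ⟶ M, ∀ v, Inside i j v.val → component f v (unitVec i j v) = x v := by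
  let h (v : Vertex ε) : space (interval k ε i j) v →ₗ[k] space M v :=
    LinearMap.toSpanSingleton k _ (x v) ∘ₗ coord i j v
  have hcomm {a b : Vertex ε} (α : a ⟶ b) : h b ∘ₗ arrowMap _ α = arrowMap M α ∘ₗ h a := by
    refine linearMap_interval_ext fun ha => ?_
    by_cases hb : Inside i j b.val
    · simp [h, arrowMap_unitVec α ha, coord_unitVec ha, coord_unitVec hb, hx α ha hb]
    · simp [h, coord_eq_zero hb, coord_unitVec ha, hout α ha hb]
  exact ⟨homMk h fun α => LinearMap.congr_fun (hcomm α), fun v hv => by simp [h, coord_unitVec hv]⟩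

theorem exists_homInterval_of_isDualSection {i j : ℕ} {φ : ∀ v, Module.Dual k (space M v)}
    (hφ : IsDualSection M i j φ)
    (hin : ∀ ⦃a b : Vertex ε⦄ (α : a ⟶ b), ¬ Inside i j a.val → Inside i j b.val →
      φ b ∘ₗ arrowMap M α = 0) :
    ∃ g : M ⟶ interval k ε i j, ∀ v, Inside i j v.val →
      ∀ y, coord i j v (component g v y) = φ v y := by
  refine ⟨homMk (fun v => LinearMap.toSpanSingleton k _ (unitVec i j v) ∘ₗ φ v)
    fun {a b} α y => space_interval_ext fun hb => ?_, fun v hv y => ?_⟩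
  · by_cases ha : Inside i j a.val
    · simp [coord_arrowMap α hb, coord_unitVec ha, coord_unitVec hb, ← hφ α ha hb]
    · have hy : φ b (arrowMap M α y) = 0 := LinearMap.congr_fun (hin α ha hb) y
      simp [coord_arrowMap α hb, coord_eq_zero ha, hy]
  · simp [coord_unitVec hv]

theorem nonempty_retract_interval {i j : ℕ} (hj : j ≤ n + 2) {x : ∀ v, space M v}
    {φ : ∀ v, Module.Dual k (space M v)} (hx : x ∈ sections M i j) (hφ : IsDualSection M i j φ)
    (hout : ∀ ⦃a b : Vertex ε⦄ (α : a ⟶ b), Inside i j a.val → ¬ Inside i j b.val →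
      arrowMap M α (x a) = 0)
    (hin : ∀ ⦃a b : Vertex ε⦄ (α : a ⟶ b), ¬ Inside i j a.val → Inside i j b.val →
      φ b ∘ₗ arrowMap M α = 0)
    {v : Vertex ε} (hv : Inside i j v.val) (hxφ : φ v (x v) ≠ 0) :
    Nonempty (Retract (interval k ε i j) M) := by
  obtain ⟨f, hf⟩ := exists_intervalHom_of_mem_sections hx hout
  obtain ⟨g, hg⟩ := exists_homInterval_of_isDualSection hφ hin
  have hfg : f ≫ g ≠ 0 := fun h => hxφ <| by
    rw [← hf v hv, ← hg v hv, component_component_of_comp_eq h, component_zero,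
      LinearMap.zero_apply, map_zero]
  have := (isBrick_interval (by omega) hj).isIso_of_ne_zero hfg
  exact nonempty_retract_of_isIso_comp f g

theorem exists_dual_comp_eq {V V' : Type*} [AddCommGroup V] [Module k V] [AddCommGroup V']
    [Module k V'] (g : V' →ₗ[k] V) (ψ : Module.Dual k V') (W : Submodule k V)
    (h : W.comap g ≤ LinearMap.ker ψ) :
    ∃ χ : Module.Dual k V, χ ∘ₗ g = ψ ∧ W ≤ LinearMap.ker χ := by
  have hψ : ψ ∈ (LinearMap.ker (W.mkQ ∘ₗ g)).dualAnnihilator := by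
    rw [LinearMap.ker_comp, Submodule.ker_mkQ]
    exact (Submodule.mem_dualAnnihilator ψ).2 fun y hy => h hy
  rw [← LinearMap.range_dualMap_eq_dualAnnihilator_ker] at hψ
  obtain ⟨χ, rfl⟩ := hψ
  refine ⟨χ ∘ₗ W.mkQ, rfl, fun w hw => ?_⟩
  rw [LinearMap.mem_ker, LinearMap.comp_apply, (Submodule.mkQ_apply W w).trans
    ((Submodule.Quotient.mk_eq_zero W).2 hw), map_zero]

open scoped Classical in
theorem forall_arrow_update {X : Vertex ε → Type*}
    {R : ∀ ⦃a b : Vertex ε⦄, (a ⟶ b) → X a → X b → Prop} {i : ℕ} {a b : Vertex ε}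
    (hab : a.val + 1 = b.val) {x : ∀ v, X v}
    (hx : ∀ ⦃c d⦄ (α : c ⟶ d), Inside i (a.val + 1) c.val → Inside i (a.val + 1) d.val →
      R α (x c) (x d))
    {y : X b} (hto : ∀ α : a ⟶ b, R α (x a) y) (hfrom : ∀ α : b ⟶ a, R α y (x a)) ⦃c d : Vertex ε⦄
    (α : c ⟶ d) (hc : Inside i (b.val + 1) c.val) (hd : Inside i (b.val + 1) d.val) :
    R α (Function.update x b y c) (Function.update x b y d) := by
  have hα := val_of_arrow α
  by_cases hcb : c = b
  · subst hcb
    obtain rfl : d = a := Fin.ext (by omega)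
    rw [Function.update_self, Function.update_of_ne (by grind)]
    exact hfrom α
  by_cases hdb : d = b
  · subst hdb
    obtain rfl : c = a := Fin.ext (by omega)
    rw [Function.update_self, Function.update_of_ne hcb]
    exact hto α
  · have hcb' : c.val ≠ b.val := fun h => hcb (Fin.ext h)
    have hdb' : d.val ≠ b.val := fun h => hdb (Fin.ext h)
    rw [Function.update_of_ne hcb, Function.update_of_ne hdb]
    exact hx α ⟨hc.1, by omega⟩ ⟨hd.1, by omega⟩

theorem exists_extension_mem_sections {i : ℕ} {a b : Vertex ε} (hab : a.val + 1 = b.val)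
    {x : ∀ v, space M v} (hx : x ∈ sections M i (a.val + 1)) {y : space M b}
    (hto : ∀ α : a ⟶ b, arrowMap M α (x a) = y) (hfrom : ∀ α : b ⟶ a, arrowMap M α y = x a) :
    ∃ x' ∈ sections M i (b.val + 1), x' b = y ∧ ∀ v, v ≠ b → x' v = x v := by
  classical
  exact ⟨Function.update x b y,
    forall_arrow_update (R := fun _ _ α u w => arrowMap M α u = w) hab hx hto hfrom,
    Function.update_self .., fun v hv => Function.update_of_ne hv ..⟩

/-- The values at `t` of the families preserved by the arrows between `s` and `t` which vanish
at `s`: a linear form at `t` extends to a dual family from `s` to `t` if and only if it kills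
them. -/
def deadVectors (M : RepQ k ε) (s t : Vertex ε) : Submodule k (space M t) :=
  (sections M s.val (t.val + 1) ⊓ LinearMap.ker (LinearMap.proj s)).map (LinearMap.proj t)

theorem mem_deadVectors {s t : Vertex ε} {y : space M t} :
    y ∈ deadVectors M s t ↔ ∃ x ∈ sections M s.val (t.val + 1), x s = 0 ∧ x t = y := by
  simp [deadVectors, and_assoc]

theorem mem_deadVectors_of_arrow {s a b : Vertex ε} (hsa : s.val ≤ a.val) (hab : a.val + 1 = b.val)
    {y : space M a} (hy : y ∈ deadVectors M s a) {z : space M b}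
    (hto : ∀ α : a ⟶ b, arrowMap M α y = z) (hfrom : ∀ α : b ⟶ a, arrowMap M α z = y) :
    z ∈ deadVectors M s b := by
  obtain ⟨x, hx, hxs, rfl⟩ := mem_deadVectors.1 hy
  obtain ⟨x', hx', hx'b, hx'v⟩ := exists_extension_mem_sections hab hx hto hfrom
  exact mem_deadVectors.2 ⟨x', hx', by rw [hx'v s (by grind), hxs], hx'b⟩

theorem arrowMap_mem_deadVectors {s a b : Vertex ε} (hsa : s.val ≤ a.val) (hab : a.val + 1 = b.val)
    (α : b ⟶ a) {z : space M b} (hz : z ∈ deadVectors M s b) :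
    arrowMap M α z ∈ deadVectors M s a := by
  obtain ⟨x, hx, hxs, rfl⟩ := mem_deadVectors.1 hz
  exact mem_deadVectors.2 ⟨x, sections_anti (by omega) hx, hxs,
    (hx α ⟨by omega, by omega⟩ ⟨hsa, by omega⟩).symm⟩

theorem exists_dual_of_deadVectors_le_ker {s a b : Vertex ε} (hsa : s.val ≤ a.val)
    (hab : a.val + 1 = b.val) {ψ : Module.Dual k (space M b)}
    (hψ : deadVectors M s b ≤ LinearMap.ker ψ) :
    ∃ ψ' : Module.Dual k (space M a), deadVectors M s a ≤ LinearMap.ker ψ' ∧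
      (∀ α : a ⟶ b, ψ ∘ₗ arrowMap M α = ψ') ∧ ∀ α : b ⟶ a, ψ' ∘ₗ arrowMap M α = ψ := by
  rcases unique_arrow_or_unique_arrow hab with ⟨⟨_⟩, _⟩ | ⟨_, ⟨_⟩⟩
  · exact ⟨ψ ∘ₗ arrowMap M default, fun y hy => hψ <| mem_deadVectors_of_arrow hsa hab hy
      (fun α => by rw [Unique.eq_default α]) isEmptyElim,
      fun α => by rw [Unique.eq_default α], isEmptyElim⟩
  · obtain ⟨χ, hχ, hχ'⟩ := exists_dual_comp_eq (arrowMap M (default : b ⟶ a)) ψ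
      (deadVectors M s a) fun z hz => hψ <| mem_deadVectors_of_arrow hsa hab hz isEmptyElim
        fun α => by rw [Unique.eq_default α]
    exact ⟨χ, hχ', isEmptyElim, fun α => by rw [Unique.eq_default α, hχ]⟩

theorem exists_isDualSection {s t : Vertex ε} (hst : s.val ≤ t.val)
    {ψ : Module.Dual k (space M t)} (hψ : deadVectors M s t ≤ LinearMap.ker ψ) :
    ∃ φ : ∀ v, Module.Dual k (space M v), IsDualSection M s.val (t.val + 1) φ ∧ φ t = ψ := by
  classical
  induction hm : t.val - s.val generalizing t with
  | zero =>
    refine ⟨Function.update 0 t ψ, fun a b α ha hb => ?_, Function.update_self ..⟩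
    have := val_of_arrow α
    omega
  | succ m ih =>
    let a : Vertex ε := ⟨t.val - 1, by omega⟩
    have hat : a.val + 1 = t.val := Nat.sub_add_cancel (by omega)
    obtain ⟨ψ', hψ', hto, hfrom⟩ := exists_dual_of_deadVectors_le_ker (by omega) hat hψ
    obtain ⟨φ, hφ, rfl⟩ := ih (t := a) (by omega) hψ' (by omega)
    exact ⟨Function.update φ t ψ, forall_arrow_update
      (R := fun _ _ α u w => w ∘ₗ arrowMap M α = u) hat hφ hto hfrom, Function.update_self ..⟩

theorem exists_mem_sections_notMem {s a b : Vertex ε} (hsa : s.val ≤ a.val)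
    (hab : a.val + 1 = b.val) {x₀ : ∀ v, space M v} (hx₀ : x₀ ∈ sections M s.val (a.val + 1))
    (hx₀a : x₀ a ∉ deadVectors M s a)
    (hb : ∀ x ∈ sections M s.val (b.val + 1), x b ∈ deadVectors M s b) :
    ∃ x ∈ sections M s.val (a.val + 1), (∀ α : a ⟶ b, arrowMap M α (x a) = 0) ∧
      ∃ W : Submodule k (space M a), deadVectors M s a ≤ W ∧ x a ∉ W ∧
        ∀ α : b ⟶ a, LinearMap.range (arrowMap M α) ≤ W := by
  rcases unique_arrow_or_unique_arrow hab with ⟨⟨_⟩, _⟩ | ⟨_, ⟨_⟩⟩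
  · obtain ⟨x₁, hx₁, hx₁b, -⟩ := exists_extension_mem_sections hab hx₀
      (y := arrowMap M default (x₀ a)) (fun α => by rw [Unique.eq_default α]) isEmptyElim
    obtain ⟨y, hy, hys, hyb⟩ := mem_deadVectors.1 (hb x₁ hx₁)
    have hy' := sections_anti (j := a.val + 1) (by omega) hy
    refine ⟨x₀ - y, sub_mem hx₀ hy', fun α => ?_, deadVectors M s a, le_rfl, fun h => hx₀a ?_,
      isEmptyElim⟩
    · rw [Pi.sub_apply, map_sub, hy α ⟨hsa, by omega⟩ ⟨by omega, by omega⟩, hyb, hx₁b,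
        Unique.eq_default α, sub_self]
    · rw [← sub_add_cancel (x₀ a) (y a)]
      exact add_mem h (mem_deadVectors.2 ⟨y, hy', hys, rfl⟩)
  · refine ⟨x₀, hx₀, isEmptyElim, deadVectors M s a ⊔ LinearMap.range (arrowMap M default),
      le_sup_left, fun h => hx₀a ?_, fun α => by rw [Unique.eq_default α]; exact le_sup_right⟩
    obtain ⟨_, hd, _, ⟨w, rfl⟩, hdw⟩ := Submodule.mem_sup.1 h
    obtain ⟨y, hy, -, rfl⟩ := mem_deadVectors.1 hd
    obtain ⟨x₁, hx₁, rfl, -⟩ := exists_extension_mem_sections hab (sub_mem hx₀ hy) (y := w)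
      isEmptyElim fun α => by rw [Unique.eq_default α, Pi.sub_apply, ← hdw, add_sub_cancel_left]
    rw [← hdw]
    exact add_mem hd (arrowMap_mem_deadVectors hsa hab _ (hb x₁ hx₁))

theorem exists_maximal_section (hM : ¬ IsZero M) :
    ∃ s t : Vertex ε, s.val ≤ t.val ∧ (∀ v : Vertex ε, v.val < s.val → Subsingleton (space M v)) ∧
      ∃ x ∈ sections M s.val (t.val + 1), ∃ W : Submodule k (space M t),
        deadVectors M s t ≤ W ∧ x t ∉ W ∧ ∀ b : Vertex ε, t.val + 1 = b.val →
          (∀ α : t ⟶ b, arrowMap M α (x t) = 0) ∧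
          ∀ α : b ⟶ t, LinearMap.range (arrowMap M α) ≤ W := by
  classical
  have : Finite (Vertex ε) := inferInstanceAs (Finite (Fin (n + 2)))
  obtain ⟨s, hs, hmin⟩ := Set.exists_min_image {v : Vertex ε | Nontrivial (space M v)}
    (fun v => v.val) (Set.toFinite _) (exists_space_nontrivial_of_not_isZero hM)
  obtain ⟨y, hy⟩ := @exists_ne _ hs 0
  obtain ⟨t, ⟨hst, x₀, hx₀, hx₀t⟩, hmax⟩ := Set.exists_max_image {t : Vertex ε | s.val ≤ t.val ∧
      ∃ x ∈ sections M s.val (t.val + 1), x t ∉ deadVectors M s t} (fun t => t.val)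
    (Set.toFinite _) ⟨s, le_rfl, Function.update 0 s y, fun a b α ha hb => by
      have := val_of_arrow α
      omega, fun h => by
      obtain ⟨x, -, h₁, h₂⟩ := mem_deadVectors.1 h
      rw [h₁, Function.update_self] at h₂
      exact hy h₂.symm⟩
  refine ⟨s, t, hst, fun v hv => not_nontrivial_iff_subsingleton.1 fun h =>
    (hmin v h).not_gt hv, ?_⟩
  by_cases ht : t.val + 1 < n + 2
  · let b : Vertex ε := ⟨t.val + 1, ht⟩
    obtain ⟨x, hx, hout, W, hW, hxW, hin⟩ := exists_mem_sections_notMem (b := b) hst rfl hx₀ hx₀t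
      fun x hx => by_contra fun hxb =>
        (hmax b ⟨hst.trans (Nat.le_succ _), x, hx, hxb⟩).not_gt (Nat.lt_succ_self _)
    refine ⟨x, hx, W, hW, hxW, fun b' hb' => ?_⟩
    obtain rfl : b' = b := Fin.ext hb'.symm
    exact ⟨hout, hin⟩
  · exact ⟨x₀, hx₀, _, le_rfl, hx₀t, fun b hb => absurd (hb ▸ b.isLt) ht⟩

theorem exists_retract_interval (hM : ¬ IsZero M) :
    ∃ i j, i < j ∧ j ≤ n + 2 ∧ Nonempty (Retract (interval k ε i j) M) := by
  obtain ⟨s, t, hst, hzero, x, hx, W, hW, hxW, hb⟩ := exists_maximal_section hM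
  obtain ⟨ψ, hψx, hψW⟩ := Submodule.exists_le_ker_of_notMem hxW
  obtain ⟨φ, hφ, rfl⟩ := exists_isDualSection hst (hW.trans hψW)
  have hoff {a b : Vertex ε} (hab : a.val + 1 = b.val ∨ b.val + 1 = a.val)
      (ha : Inside s.val (t.val + 1) a.val) (hb : ¬ Inside s.val (t.val + 1) b.val) :
      Subsingleton (space M b) ∨ a = t ∧ t.val + 1 = b.val := by
    by_cases hbs : b.val < s.val
    · exact Or.inl (hzero b hbs)
    · exact Or.inr ⟨Fin.ext (by omega), by omega⟩
  refine ⟨s.val, t.val + 1, by omega, t.isLt, nonempty_retract_interval t.isLt hx hφ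
    (fun a b α ha hb' => ?_) (fun b a α hb' ha => ?_) ⟨hst, Nat.lt_succ_self _⟩ hψx⟩
  · have hα := val_of_arrow α
    obtain h | ⟨rfl, htb⟩ := hoff (by tauto) ha hb'
    · exact Subsingleton.elim _ _
    · exact (hb b htb).1 α
  · have hα := val_of_arrow α
    obtain h | ⟨rfl, htb⟩ := hoff (by tauto) ha hb'
    · exact Subsingleton.elim _ _
    · exact LinearMap.range_le_ker_iff.1 (((hb b htb).2 α).trans hψW)

end Classification

section Indecomposables

theorem nonempty_iso_of_retract {C : Type*} [Category* C] [Abelian C] {A T : C} (hA : ¬ IsZero A)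
    (hT : Indecomposable T) (h : Retract A T) : Nonempty (A ≅ T) := by
  obtain ⟨Z, ⟨e⟩⟩ := nonempty_retract_iff.1 ⟨h⟩
  have hZ : IsZero Z := (hT.2 A Z e).resolve_left hA
  exact ⟨isoBiprodZero hZ ≪≫ e.symm⟩

variable {k : Type u} [Field k] {n : ℕ} {ε : Fin (n + 1) → Bool} {M : RepQ k ε}
  {γ δ : LineSegment n}

variable (k ε) in
theorem isBrick_F (γ : LineSegment n) : IsBrick k (F k ε γ) :=
  isBrick_interval γ.lt (by omega)

theorem exists_retract_F (hM : ¬ IsZero M) :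
    ∃ γ : LineSegment n, Nonempty (Retract (F k ε γ) M) := by
  obtain ⟨i, j, hij, hj, h⟩ := exists_retract_interval hM
  exact ⟨⟨⟨i, by omega⟩, ⟨j, by omega⟩, hij⟩, h⟩

theorem exists_iso_F (hM : Indecomposable M) : ∃ γ : LineSegment n, Nonempty (F k ε γ ≅ M) := by
  obtain ⟨γ, ⟨h⟩⟩ := exists_retract_F hM.1
  exact ⟨γ, nonempty_iso_of_retract (isBrick_F k ε γ).not_isZero hM h⟩

theorem finrank_space_F (v : Vertex ε) :
    Module.finrank k (space (F k ε γ) v) = if Inside γ.i γ.j v.val then 1 else 0 :=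
  finrank_space_interval v

theorem eq_of_iso_F (e : F k ε γ ≅ F k ε δ) : γ = δ := by
  have h (v : ℕ) (hv : v < n + 2) : Inside γ.i γ.j v ↔ Inside δ.i δ.j v := by
    let w : Vertex ε := ⟨v, hv⟩
    have hdim := (finrank_space_F w).symm.trans
      ((finrank_space_eq_of_iso e w).trans (finrank_space_F w))
    grind
  have hγ := γ.lt
  have hδ := δ.lt
  have h₁ := h γ.i (by omega)
  have h₂ := h δ.i (by omega)
  have h₃ := h (γ.j - 1) (by omega)
  have h₄ := h (δ.j - 1) (by omega)
  refine LineSegment.ext (Fin.ext ?_) (Fin.ext ?_) <;> omega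

theorem nonempty_retract_F_iff : Nonempty (Retract (F k ε γ) (F k ε δ)) ↔ γ = δ := by
  refine ⟨fun ⟨h⟩ => ?_, fun h => h ▸ ⟨Retract.refl _⟩⟩
  obtain ⟨e⟩ :=
    nonempty_iso_of_retract (isBrick_F k ε γ).not_isZero (isBrick_F k ε δ).indecomposable h
  exact eq_of_iso_F e

theorem subsingleton_or_extGeneratedByIndec_F_iff :
    Subsingleton (Abelian.Ext (F k ε γ) (F k ε δ) 1) ∨
      ExtGeneratedByIndec (F k ε γ) (F k ε δ) ↔ ¬ CrossesUpward ε γ δ := by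
  have hγ := γ.lt
  have hδ := δ.lt
  constructor
  · rintro h ⟨hstart, hend, hlt⟩
    rcases h with h | ⟨-, E, f, g, w, hS, -, hE⟩
    · exact not_subsingleton_ext_one_of_hasExtension γ.lt (by omega) δ.lt (by omega)
        ⟨hstart, hend, hlt.le⟩ h
    · obtain ⟨η, ⟨e⟩⟩ := exists_iso_F hE
      let v : Vertex ε := ⟨max γ.i.val δ.i.val, by omega⟩
      have hv := finrank_space_of_shortExact hS v
      rw [← finrank_space_eq_of_iso e v, finrank_space_F, finrank_space_F, finrank_space_F] at hv
      grind
  · intro h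
    by_cases hext : HasExtension ε γ.i γ.j δ.i δ.j
    · refine Or.inr (extGeneratedByIndec_interval γ.lt (by omega) δ.lt (by omega) hext ?_)
      exact hext.2.2.antisymm (not_lt.1 fun hlt => h ⟨hext.1, hext.2.1, hlt⟩)
    · exact Or.inl (subsingleton_ext_one_of_not_hasExtension γ.lt δ.lt hext)

end Indecomposables

/-! ### Crossings of line segments -/

section Geometry

/-- The height at abscissa `x` of the line through `P` and `Q`. The slope of a vertical line is the
junk value `0`. -/
def lineHeight (P Q : ℝ × ℝ) (x : ℝ) : ℝ :=
  P.2 + (Q.2 - P.2) / (Q.1 - P.1) * (x - P.1)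

@[simp] theorem lineHeight_left (P Q : ℝ × ℝ) : lineHeight P Q P.1 = P.2 := by
  simp [lineHeight]

theorem lineHeight_right {P Q : ℝ × ℝ} (h : P.1 < Q.1) : lineHeight P Q Q.1 = Q.2 := by
  rw [lineHeight, div_mul_cancel₀ _ (sub_ne_zero.2 h.ne'), add_sub_cancel]

theorem continuous_lineHeight (P Q : ℝ × ℝ) : Continuous (lineHeight P Q) := by
  unfold lineHeight
  fun_prop

theorem mem_openSegment_iff {P Q z : ℝ × ℝ} (h : P.1 < Q.1) :
    z ∈ openSegment ℝ P Q ↔ z.1 ∈ Set.Ioo P.1 Q.1 ∧ z.2 = lineHeight P Q z.1 := by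
  have hne : Q.1 - P.1 ≠ 0 := sub_ne_zero.2 h.ne'
  rw [openSegment_eq_image']
  constructor
  · rintro ⟨θ, ⟨h0, h1⟩, rfl⟩
    refine ⟨⟨?_, ?_⟩, ?_⟩
    · simpa using mul_pos h0 (sub_pos.2 h)
    · simpa using by nlinarith
    · simp only [Prod.snd_add, Prod.smul_snd, Prod.snd_sub, smul_eq_mul, lineHeight, Prod.fst_add,
        Prod.smul_fst, Prod.fst_sub, add_sub_cancel_left, add_right_inj]
      field_simp
  · rintro ⟨⟨h0, h1⟩, hz⟩
    refine ⟨(z.1 - P.1) / (Q.1 - P.1), ⟨by bound, ?_⟩, Prod.ext ?_ ?_⟩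
    · rw [div_lt_one (sub_pos.2 h)]
      linarith
    · simp [div_mul_cancel₀ _ hne]
    · rw [hz, lineHeight]
      simp only [Prod.snd_add, Prod.smul_snd, Prod.snd_sub, smul_eq_mul, add_right_inj]
      ring

theorem exists_lineHeight_eq_of_lt {P Q P' Q' : ℝ × ℝ} {u w : ℝ} (huw : u < w)
    (hu : lineHeight P Q u < lineHeight P' Q' u) (hw : lineHeight P' Q' w < lineHeight P Q w) :
    ∃ x ∈ Set.Ioo u w, lineHeight P Q x = lineHeight P' Q' x := by
  obtain ⟨x, hx, h⟩ := intermediate_value_Ioo huw.le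
    ((continuous_lineHeight P Q).sub (continuous_lineHeight P' Q')).continuousOn
    ⟨sub_neg.2 hu, sub_pos.2 hw⟩
  exact ⟨x, hx, sub_eq_zero.1 h⟩

theorem exists_lineHeight_eq_iff {P Q P' Q' : ℝ × ℝ} {u w : ℝ} (huw : u < w)
    (h : lineHeight P Q u ≠ lineHeight P' Q' u ∨ lineHeight P Q w ≠ lineHeight P' Q' w) :
    (∃ x ∈ Set.Ioo u w, lineHeight P Q x = lineHeight P' Q' x) ↔
      lineHeight P Q u < lineHeight P' Q' u ∧ lineHeight P' Q' w < lineHeight P Q w ∨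
      lineHeight P' Q' u < lineHeight P Q u ∧ lineHeight P Q w < lineHeight P' Q' w := by
  constructor
  · rintro ⟨x, ⟨hux, hxw⟩, hx⟩
    have hconvex : (w - x) * (lineHeight P Q u - lineHeight P' Q' u) +
        (x - u) * (lineHeight P Q w - lineHeight P' Q' w) =
        (w - u) * (lineHeight P Q x - lineHeight P' Q' x) := by
      simp only [lineHeight]
      ring
    rw [hx, sub_self, mul_zero] at hconvex
    rcases lt_trichotomy (lineHeight P Q u) (lineHeight P' Q' u) with hu | hu | hu
    · exact Or.inl ⟨hu, by nlinarith⟩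
    · exact absurd (by simpa [hu, sub_eq_zero, hux.ne'] using hconvex) (h.resolve_left (· hu))
    · exact Or.inr ⟨hu, by nlinarith⟩
  · rintro (⟨hu, hw⟩ | ⟨hu, hw⟩)
    · exact exists_lineHeight_eq_of_lt huw hu hw
    · obtain ⟨x, hx, h⟩ := exists_lineHeight_eq_of_lt huw hu hw
      exact ⟨x, hx, h.symm⟩

theorem mk_mem_of_convex {C : Set (ℝ × ℝ)} (hC : Convex ℝ C) {x y y₁ y₂ : ℝ} (h₁ : (x, y₁) ∈ C)
    (h₂ : (x, y₂) ∈ C) (hy₁ : y₁ ≤ y) (hy₂ : y ≤ y₂) : (x, y) ∈ C := by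
  refine hC.segment_subset h₁ h₂ ?_
  rw [← Prod.image_mk_segment_right, segment_eq_Icc (hy₁.trans hy₂)]
  exact ⟨y, ⟨hy₁, hy₂⟩, rfl⟩

theorem mk_lineHeight_mem_of_convex {C : Set (ℝ × ℝ)} (hC : Convex ℝ C) {P Q : ℝ × ℝ} (hP : P ∈ C)
    (hQ : Q ∈ C) {x : ℝ} (hPx : P.1 < x) (hxQ : x < Q.1) : (x, lineHeight P Q x) ∈ C :=
  hC.openSegment_subset hP hQ ((mem_openSegment_iff (hPx.trans hxQ)).2 ⟨⟨hPx, hxQ⟩, rfl⟩)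

theorem cross_comm {n : ℕ} (p : Fin (n + 3) → ℝ × ℝ) (γ δ : LineSegment n) :
    Cross p γ δ ↔ Cross p δ γ := by
  rw [Cross, Cross, ne_comm, Set.inter_comm]

namespace IsPolygon

variable {n : ℕ} {ε : Fin (n + 1) → Bool} {p : Fin (n + 3) → ℝ × ℝ} {a b c : Fin (n + 3)}

theorem lt_of_isUpper (hp : IsPolygon ε p) (h : IsUpper ε b) : (p 0).2 < (p b).2 := by
  obtain ⟨e, he, hε⟩ := h
  obtain rfl : e.succ.castSucc = b := Fin.ext he
  exact hp.upper e hε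

theorem gt_of_not_isUpper (hp : IsPolygon ε p) (hab : a < b) (hbc : b < c) (h : ¬ IsUpper ε b) :
    (p b).2 < (p 0).2 := by
  let e : Fin (n + 1) := ⟨b - 1, by omega⟩
  have he : e.val + 1 = b := Nat.sub_add_cancel (by omega)
  rw [← show e.succ.castSucc = b from Fin.ext he]
  exact hp.lower e (Bool.eq_false_iff.2 fun hε => h ⟨e, he, hε⟩)

theorem lineHeight_lt_or_gt (hp : IsPolygon ε p) (hab : a < b) (hbc : b < c) :
    IsUpper ε b ∧ lineHeight (p a) (p c) (p b).1 < (p b).2 ∨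
      ¬ IsUpper ε b ∧ (p b).2 < lineHeight (p a) (p c) (p b).1 := by
  have h0 : 0 < b := (Fin.zero_le a).trans_lt hab
  have hlast : b < Fin.last (n + 2) := hbc.trans_le (Fin.le_last c)
  let S : Set (Fin (n + 3)) := {a, c, 0, Fin.last (n + 2)}
  have hb : p b ∉ convexHull ℝ (p '' S) := fun h => by
    simpa [S, hab.ne', hbc.ne, h0.ne', hlast.ne] using hp.convex S b h
  have hC : Convex ℝ (convexHull ℝ (p '' S)) := convex_convexHull ℝ _
  have hS {v : Fin (n + 3)} (hv : v ∈ S) : p v ∈ convexHull ℝ (p '' S) :=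
    subset_convexHull ℝ _ (Set.mem_image_of_mem p hv)
  have hchord : ((p b).1, lineHeight (p a) (p c) (p b).1) ∈ convexHull ℝ (p '' S) :=
    mk_lineHeight_mem_of_convex hC (hS (by simp [S])) (hS (by simp [S])) (hp.left_to_right hab)
      (hp.left_to_right hbc)
  have hline : ((p b).1, (p 0).2) ∈ convexHull ℝ (p '' S) := by
    have := mk_lineHeight_mem_of_convex hC (hS (v := 0) (by simp [S]))
      (hS (v := Fin.last (n + 2)) (by simp [S])) (hp.left_to_right h0) (hp.left_to_right hlast)
    rwa [lineHeight, ← hp.horizontal, sub_self, zero_div, zero_mul, add_zero] at this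
  by_cases hu : IsUpper ε b
  · refine Or.inl ⟨hu, not_le.1 fun hle => hb ?_⟩
    exact mk_mem_of_convex hC hline hchord (hp.lt_of_isUpper hu).le hle
  · refine Or.inr ⟨hu, not_le.1 fun hle => hb ?_⟩
    exact mk_mem_of_convex hC hchord hline hle (hp.gt_of_not_isUpper hab hbc hu).le

variable {γ δ : LineSegment n}

theorem lineHeight_lt_iff_startsBelow (hp : IsPolygon ε p)
    (h : max γ.i δ.i < min γ.j δ.j) :
    lineHeight (p γ.i) (p γ.j) (p (max γ.i δ.i)).1 <
      lineHeight (p δ.i) (p δ.j) (p (max γ.i δ.i)).1 ↔ StartsBelow ε γ.i δ.i := by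
  simp only [max_lt_iff, lt_min_iff] at h
  unfold StartsBelow
  rcases lt_trichotomy γ.i δ.i with hi | hi | hi
  · have := hp.lineHeight_lt_or_gt hi h.1.2
    rw [max_eq_right hi.le, lineHeight_left]
    grind
  · simp [hi]
  · have := hp.lineHeight_lt_or_gt hi h.2.1
    rw [max_eq_left hi.le, lineHeight_left]
    grind

theorem lineHeight_lt_iff_endsAbove (hp : IsPolygon ε p)
    (h : max γ.i δ.i < min γ.j δ.j) :
    lineHeight (p δ.i) (p δ.j) (p (min γ.j δ.j)).1 <
      lineHeight (p γ.i) (p γ.j) (p (min γ.j δ.j)).1 ↔ EndsAbove ε γ.j δ.j := by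
  have hγ := lineHeight_right (hp.left_to_right γ.lt)
  have hδ := lineHeight_right (hp.left_to_right δ.lt)
  simp only [max_lt_iff, lt_min_iff] at h
  unfold EndsAbove
  rcases lt_trichotomy γ.j δ.j with hj | hj | hj
  · have := hp.lineHeight_lt_or_gt h.1.2 hj
    rw [min_eq_left hj.le, hγ]
    grind
  · rw [hj] at hγ
    simp [hj, hγ, hδ]
  · have := hp.lineHeight_lt_or_gt h.2.1 hj
    rw [min_eq_right hj.le, hδ]
    grind

theorem cross_iff_exists (hp : IsPolygon ε p) : Cross p γ δ ↔ γ ≠ δ ∧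
    ∃ x ∈ Set.Ioo (p (max γ.i δ.i)).1 (p (min γ.j δ.j)).1,
      lineHeight (p γ.i) (p γ.j) x = lineHeight (p δ.i) (p δ.j) x := by
  have hmono : Monotone fun v => (p v).1 := hp.left_to_right.monotone
  have hmax : (p (max γ.i δ.i)).1 = max (p γ.i).1 (p δ.i).1 := hmono.map_max
  have hmin : (p (min γ.j δ.j)).1 = min (p γ.j).1 (p δ.j).1 := hmono.map_min
  rw [hmax, hmin, ← Set.Ioo_inter_Ioo, Cross]
  simp only [Set.Nonempty, Set.mem_inter_iff, mem_openSegment_iff (hp.left_to_right γ.lt),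
    mem_openSegment_iff (hp.left_to_right δ.lt)]
  refine and_congr_right fun _ => ⟨fun ⟨z, hγ, hδ⟩ => ⟨z.1, ⟨hγ.1, hδ.1⟩, hγ.2.symm.trans hδ.2⟩, ?_⟩
  exact fun ⟨x, ⟨hγ, hδ⟩, h⟩ => ⟨(x, _), ⟨hγ, rfl⟩, hδ, h⟩

theorem cross_iff_crossesUpward (hp : IsPolygon ε p) :
    Cross p γ δ ↔ CrossesUpward ε γ δ ∨ CrossesUpward ε δ γ := by
  rw [hp.cross_iff_exists]
  by_cases h : max γ.i δ.i < min γ.j δ.j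
  · have h' : max δ.i γ.i < min δ.j γ.j := by rwa [max_comm, min_comm]
    have hstart := hp.lineHeight_lt_iff_startsBelow h
    have hstart' := hp.lineHeight_lt_iff_startsBelow h'
    have hend := hp.lineHeight_lt_iff_endsAbove h
    have hend' := hp.lineHeight_lt_iff_endsAbove h'
    rw [max_comm] at hstart'
    rw [min_comm] at hend'
    by_cases hγδ : γ = δ
    · simp [hγδ, CrossesUpward, StartsBelow]
    rw [and_iff_right hγδ, exists_lineHeight_eq_iff (hp.left_to_right h), hstart, hend, hstart',
      hend']
    · unfold CrossesUpward
      grind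
    · by_contra! heq
      rw [heq.1, lt_self_iff_false, false_iff] at hstart hstart'
      rw [heq.2, lt_self_iff_false, false_iff] at hend hend'
      unfold StartsBelow at *
      unfold EndsAbove at *
      exact hγδ (LineSegment.ext (by grind) (by grind))
  · have hlt : ¬ (p (max γ.i δ.i)).1 < (p (min γ.j δ.j)).1 :=
      (hp.left_to_right.lt_iff_lt).not.2 h
    rw [Set.Ioo_eq_empty hlt]
    unfold CrossesUpward
    grind

end IsPolygon

end Geometry

/-! ### Maximal almost rigid representations -/

section Summands

variable {k : Type u} [Field k] {n : ℕ} {ε : Fin (n + 1) → Bool} {T T' X Y M A B : RepQ k ε}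
  {γ δ : LineSegment n} {S : Set (LineSegment n)}

/-- The set of line segments `γ` such that `F γ` is a direct summand of `T`. -/
def summands (T : RepQ k ε) : Set (LineSegment n) :=
  {γ | Nonempty (Retract (F k ε γ) T)}

theorem summands_eq_of_iso (e : T ≅ T') : summands T = summands T' :=
  Set.ext fun _ => ⟨fun ⟨h⟩ => ⟨h.trans (Retract.ofIso e)⟩,
    fun ⟨h⟩ => ⟨h.trans (Retract.ofIso e.symm)⟩⟩

theorem summands_biprod (X Y : RepQ k ε) : summands (X ⊞ Y) = summands X ∪ summands Y :=
  Set.ext fun γ => (isBrick_F k ε γ).nonempty_retract_biprod_iff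

variable (k ε) in
theorem summands_F (γ : LineSegment n) : summands (F k ε γ) = {γ} :=
  Set.ext fun _ => nonempty_retract_F_iff

theorem summands_eq_empty_iff : summands M = ∅ ↔ IsZero M := by
  refine ⟨fun h => ?_, fun h => Set.eq_empty_of_forall_notMem fun γ ⟨hγ⟩ => ?_⟩
  · by_contra hM
    exact Set.nonempty_iff_ne_empty.1 (exists_retract_F hM) h
  · exact (isBrick_F k ε γ).not_isZero (h.of_mono hγ.i)

theorem isIndecSummand_iff : IsIndecSummand A T ↔ ∃ γ ∈ summands T, Nonempty (F k ε γ ≅ A) := by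
  rw [IsIndecSummand, ← nonempty_retract_iff]
  constructor
  · rintro ⟨hA, ⟨h⟩⟩
    obtain ⟨γ, ⟨e⟩⟩ := exists_iso_F hA
    exact ⟨γ, ⟨(Retract.ofIso e).trans h⟩, ⟨e⟩⟩
  · rintro ⟨γ, ⟨h⟩, ⟨e⟩⟩
    obtain ⟨hzero, hsplit⟩ := (isBrick_F k ε γ).indecomposable
    exact ⟨⟨fun hA => hzero (hA.of_iso e), fun Y Z f => hsplit Y Z (e ≪≫ f)⟩,
      ⟨(Retract.ofIso e.symm).trans h⟩⟩

theorem isBasic_iff : IsBasic T ↔ ∀ γ, IsEmpty (Retract (F k ε γ ⊞ F k ε γ) T) := by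
  simp only [IsBasic, ← nonempty_retract_iff, not_nonempty_iff]
  refine ⟨fun h γ => h _ (isBrick_F k ε γ).indecomposable, fun h A hA => ⟨fun r => ?_⟩⟩
  obtain ⟨γ, ⟨e⟩⟩ := exists_iso_F hA
  exact (h γ).false ((Retract.ofIso (biprod.mapIso e e)).trans r)

theorem IsBasic.of_iso (e : T ≅ T') (h : IsBasic T) : IsBasic T' :=
  fun A hA ⟨Z, ⟨e'⟩⟩ => h A hA ⟨Z, ⟨e ≪≫ e'⟩⟩

theorem isBasic_biprod_iff :
    IsBasic (X ⊞ Y) ↔ IsBasic X ∧ IsBasic Y ∧ Disjoint (summands X) (summands Y) := by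
  simp only [isBasic_iff, Set.disjoint_left]
  constructor
  · intro h
    refine ⟨fun γ => ⟨fun r => ?_⟩, fun γ => ⟨fun r => ?_⟩, fun γ ⟨hX⟩ ⟨hY⟩ => ?_⟩
    · exact (h γ).false (r.trans (retractBiprodLeft X Y))
    · exact (h γ).false (r.trans (retractBiprodRight X Y))
    · exact (h γ).false (retractBiprodMap hX hY)
  · rintro ⟨hX, hY, hXY⟩ γ
    refine ⟨fun r => ?_⟩
    by_cases hγ : γ ∈ summands Y
    · obtain ⟨r'⟩ := (isBrick_F k ε γ).nonempty_retract_biprod_self_left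
        (not_nonempty_iff.1 fun h => hXY h hγ) (r.trans (Retract.ofIso (biprod.braiding X Y)))
      exact (hY γ).false r'
    · obtain ⟨r'⟩ := (isBrick_F k ε γ).nonempty_retract_biprod_self_left
        (not_nonempty_iff.1 hγ) r
      exact (hX γ).false r'

variable (k ε) in
theorem isBasic_F (γ : LineSegment n) : IsBasic (F k ε γ) := by
  refine isBasic_iff.2 fun δ => ⟨fun r => ?_⟩
  obtain rfl : δ = γ := nonempty_retract_F_iff.1 ⟨(retractBiprodLeft _ _).trans r⟩
  exact (isEmpty_retract_biprod_self (isBrick_F k ε δ).indecomposable).false r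

theorem isBasic_biprod_F_iff : IsBasic (T ⊞ F k ε δ) ↔ IsBasic T ∧ δ ∉ summands T := by
  rw [isBasic_biprod_iff, and_iff_right (isBasic_F k ε δ), summands_F,
    Set.disjoint_singleton_right]

/-- The representation `⨁ F(γ)` attached to a set of line segments. -/
abbrev FSum (k : Type u) [Field k] {n : ℕ} (ε : Fin (n + 1) → Bool) (S : Set (LineSegment n)) :
    RepQ k ε :=
  ⨁ fun γ : S => F k ε γ.1

variable (k ε) in
theorem isZero_FSum_empty : IsZero (FSum k ε ∅) :=
  (IsZero.iff_id_eq_zero _).2 (biproduct.hom_ext' _ _ fun γ => γ.2.elim)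

variable (k ε) in
theorem summands_FSum (S : Set (LineSegment n)) : summands (FSum k ε S) = S := by
  induction S, S.toFinite using Set.Finite.induction_on with
  | empty => exact summands_eq_empty_iff.2 (isZero_FSum_empty k ε)
  | insert ha _ ih =>
    rw [summands_eq_of_iso (biproductInsertIso (F k ε) ha), summands_biprod, ih, summands_F,
      Set.union_singleton]

variable (k ε) in
theorem isBasic_FSum (S : Set (LineSegment n)) : IsBasic (FSum k ε S) := by
  induction S, S.toFinite using Set.Finite.induction_on with
  | empty =>
    refine isBasic_iff.2 fun γ => ⟨fun r => ?_⟩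
    exact (summands_FSum k ε ∅).le
      (show γ ∈ summands _ from ⟨(retractBiprodLeft _ _).trans r⟩)
  | @insert a S ha _ ih =>
    refine IsBasic.of_iso (biproductInsertIso (F k ε) ha).symm (isBasic_biprod_F_iff.2 ⟨ih, ?_⟩)
    rwa [← summands_FSum k ε S] at ha

theorem exists_iso_FSum_biprod (hS : S ⊆ summands T) : ∃ Z, Nonempty (T ≅ FSum k ε S ⊞ Z) := by
  induction S, S.toFinite using Set.Finite.induction_on with
  | empty => exact ⟨T, ⟨isoZeroBiprod (isZero_FSum_empty k ε)⟩⟩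
  | @insert a S ha _ ih =>
    obtain ⟨Z, ⟨e⟩⟩ := ih ((Set.subset_insert a S).trans hS)
    have haZ : a ∈ summands Z := by
      have := hS (Set.mem_insert a S)
      rw [summands_eq_of_iso e, summands_biprod, summands_FSum] at this
      exact this.resolve_left ha
    obtain ⟨Z', ⟨e'⟩⟩ := nonempty_retract_iff.1 haZ
    exact ⟨Z', ⟨e ≪≫ biprod.mapIso (Iso.refl _) e' ≪≫ (biprod.associator _ _ _).symm ≪≫
      biprod.mapIso (biproductInsertIso (F k ε) ha).symm (Iso.refl _)⟩⟩

theorem IsBasic.nonempty_iso_FSum_summands (hT : IsBasic T) :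
    Nonempty (T ≅ FSum k ε (summands T)) := by
  obtain ⟨Z, ⟨e⟩⟩ := exists_iso_FSum_biprod (subset_refl (summands T))
  have hdisj := (isBasic_biprod_iff.1 (hT.of_iso e)).2.2
  have hZ : summands Z ⊆ summands T := by
    rw [summands_eq_of_iso e, summands_biprod]
    exact Set.subset_union_right
  rw [summands_FSum] at hdisj
  have hzero : IsZero Z := summands_eq_empty_iff.1 (hdisj.eq_bot_of_ge hZ)
  exact ⟨e ≪≫ (isoBiprodZero hzero).symm⟩

end Summands

section MaximalAlmostRigid

variable {k : Type u} [Field k] {n : ℕ} {ε : Fin (n + 1) → Bool} {p : Fin (n + 3) → ℝ × ℝ}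
  {T A A' B B' : RepQ k ε} {γ δ : LineSegment n}

theorem ExtGeneratedByIndec.of_iso (e : A ≅ A') (e' : B ≅ B') (h : ExtGeneratedByIndec A B) :
    ExtGeneratedByIndec A' B' := by
  obtain ⟨hdim, E, f, g, w, hS, hspan, hE⟩ := h
  have w' : (e'.inv ≫ f) ≫ g ≫ e.hom = 0 := by simp [reassoc_of% w]
  let i : ShortComplex.mk f g w ≅ ShortComplex.mk (e'.inv ≫ f) (g ≫ e.hom) w' :=
    ShortComplex.isoMk e' (Iso.refl _) e (by simp) (by simp)
  have hS' := ShortComplex.shortExact_of_iso i hS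
  have hclass : extCongr (k := k) e e' hS.extClass = hS'.extClass := by
    have hnat : hS.extClass.comp (Abelian.Ext.mk₀ e'.hom) (add_zero 1) =
        (Abelian.Ext.mk₀ e.hom).comp hS'.extClass (zero_add 1) :=
      ShortComplex.ShortExact.extClass_naturality hS hS' i.hom
    refine (congrArg (fun x => (Abelian.Ext.mk₀ e.inv).comp x (zero_add 1)) hnat).trans ?_
    rw [Abelian.Ext.mk₀_comp_mk₀_assoc, e.inv_hom_id, Abelian.Ext.mk₀_id_comp]
  refine ⟨(extCongr (k := k) e e').finrank_eq.symm.trans hdim, E, _, _, w', hS', ?_, hE⟩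
  rw [← hclass, ← Set.image_singleton, ← LinearEquiv.coe_coe, ← Submodule.map_span, hspan,
    Submodule.map_top, LinearEquiv.range]

theorem isAlmostRigid_iff (hp : IsPolygon ε p) :
    IsAlmostRigid T ↔ IsBasic T ∧ ∀ γ ∈ summands T, ∀ δ ∈ summands T, ¬ Cross p γ δ := by
  simp only [hp.cross_iff_crossesUpward, not_or, IsAlmostRigid, isIndecSummand_iff]
  refine and_congr_right fun _ => ⟨fun h γ hγ δ hδ => ⟨?_, ?_⟩, ?_⟩
  · exact subsingleton_or_extGeneratedByIndec_F_iff.1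
      (h _ _ ⟨γ, hγ, ⟨Iso.refl _⟩⟩ ⟨δ, hδ, ⟨Iso.refl _⟩⟩)
  · exact subsingleton_or_extGeneratedByIndec_F_iff.1
      (h _ _ ⟨δ, hδ, ⟨Iso.refl _⟩⟩ ⟨γ, hγ, ⟨Iso.refl _⟩⟩)
  · rintro h A B ⟨γ, hγ, ⟨e⟩⟩ ⟨δ, hδ, ⟨e'⟩⟩
    refine (subsingleton_or_extGeneratedByIndec_F_iff.2 (h γ hγ δ hδ).1).imp ?_
      (ExtGeneratedByIndec.of_iso e e')
    intro
    exact (extCongr (k := k) e e').symm.toEquiv.subsingleton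

theorem isMaximalAlmostRigid_iff (hp : IsPolygon ε p) :
    IsMaximalAlmostRigid T ↔ IsBasic T ∧ IsTriangulation p (summands T) := by
  simp only [IsMaximalAlmostRigid, isAlmostRigid_iff hp, summands_biprod]
  constructor
  · rintro ⟨⟨hT, hcross⟩, hmax⟩
    refine ⟨hT, hcross, fun S hS hTS δ hδ => ?_⟩
    by_contra hδT
    refine hmax (F k ε δ) (isBrick_F k ε δ).not_isZero ⟨isBasic_biprod_F_iff.2 ⟨hT, hδT⟩, ?_⟩
    have hsub : summands T ∪ summands (F k ε δ) ⊆ S := by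
      rw [summands_F, Set.union_singleton]
      exact Set.insert_subset hδ hTS
    exact fun γ hγ γ' hγ' => hS γ (hsub hγ) γ' (hsub hγ')
  · rintro ⟨hT, hcross, hmax⟩
    refine ⟨⟨hT, hcross⟩, fun M hM ⟨hTM, hcross'⟩ => hM (summands_eq_empty_iff.1 ?_)⟩
    have hsub : summands M ⊆ summands T :=
      Set.subset_union_right.trans (hmax hcross' Set.subset_union_left)
    exact (isBasic_biprod_iff.1 hTM).2.2.eq_bot_of_ge hsub

end MaximalAlmostRigid

end AlmostRigid

end

open AlmostRigid

theorem theorem2_general (k : Type u) [Field k] (n : ℕ) (ε : Fin (n + 1) → Bool)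
    (p : Fin (n + 3) → ℝ × ℝ) (hp : IsPolygon ε p) :
    Set.BijOn (FSet k ε) {T | IsTriangulation p T} (mar k ε) ∧
      ∀ γ δ : LineSegment n, γ ≠ δ →
        (IsAlmostRigid (F k ε γ ⊞ F k ε δ) ↔ ¬ Cross p γ δ) := by
  refine ⟨⟨fun S hS => ?_, fun S _ S' _ h => ?_, ?_⟩, fun γ δ hne => ?_⟩
  · refine ⟨FSum k ε S, (isMaximalAlmostRigid_iff hp).2 ⟨isBasic_FSum k ε S, ?_⟩, rfl⟩
    rwa [summands_FSum]
  · obtain ⟨e⟩ : Nonempty (FSum k ε S ≅ FSum k ε S') := Quotient.exact h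
    rw [← summands_FSum k ε S, summands_eq_of_iso e, summands_FSum]
  · rintro _ ⟨T, hT, rfl⟩
    obtain ⟨hbasic, hT⟩ := (isMaximalAlmostRigid_iff hp).1 hT
    obtain ⟨e⟩ := hbasic.nonempty_iso_FSum_summands
    exact ⟨summands T, hT, Quotient.sound ⟨e.symm⟩⟩
  · have hself (η : LineSegment n) : ¬ Cross p η η := fun h => h.1 rfl
    simp [isAlmostRigid_iff hp, isBasic_biprod_F_iff, isBasic_F, summands_biprod, summands_F,
      hne.symm, cross_comm p δ γ, hself]

theorem theorem2 (k : Type u) [Field k] [IsAlgClosed k] (n : ℕ) (ε : Fin (n + 1) → Bool)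
    (p : Fin (n + 3) → ℝ × ℝ) (hp : AlmostRigid.IsPolygon ε p) :
    Set.BijOn (AlmostRigid.FSet k ε) {T | AlmostRigid.IsTriangulation p T}
        (AlmostRigid.mar k ε) ∧
      ∀ γ δ : AlmostRigid.LineSegment n, γ ≠ δ →
        (AlmostRigid.IsAlmostRigid (AlmostRigid.F k ε γ ⊞ AlmostRigid.F k ε δ) ↔
          ¬ AlmostRigid.Cross p γ δ) := by
  exact theorem2_general k n ε p hp
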